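/- Let $\mathbb S^1=\mathbb R/\mathbb Z$ with geodesic distance $d(x,y)=\min_{k\in\mathbb Z}|x-y-k|$, and for $k\ge 0$ let $H^k=H^k(\mathbb S^1;\mathbb R^2)$ be the $L^2$-based Sobolev space with norm $\|u\|_{H^k}^2=\sum_{j=0}^k\|\partial_x^j u\|_{L^2}^2$; elements of $H^1$ are identified with their continuous representatives, and elements of $H^2$ with their $C^1$ representatives. For $\gamma\in H^2$ put $$|\gamma|_*=\inf_{x\ne y}\frac{|\gamma(x)-\gamma(y)|}{d(x,y)},\qquad V=\{\gamma\in H^2 : |\gamma|_*>0\}.$$ For $\gamma\in V$ define $$\tau(\gamma)=\frac{\gamma'}{|\gamma'|},\qquad \nu(\gamma)=\begin{pmatrix}0&1\\-1&0\end{pmatrix}\tau(\gamma),\qquad \kappa(\gamma)=-\frac{\nu(\gamma)\cdot\gamma''}{|\gamma'|},$$ and, with $\Delta\gamma(x,y)=\gamma(y)-\gamma(x)$, $$K(\gamma)(x,y)=\frac{(\nu(\gamma)(x)\cdot\Delta\gamma(x,y))\,(\nu(\gamma)(y)\cdot\Delta\gamma(x,y))}{|\Delta\gamma(x,y)|^3}\quad(x\ne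 y),$$ $$F(\gamma)(x)=-\frac1{2\pi}\int_{\mathbb S^1}K(\gamma)(x,y)\,\kappa(\gamma)(y)\,dy,\qquad f(\gamma)(x)=F(\gamma)(x)\,\nu(\gamma)(x).$$ Then $V$ is open in $H^2$; for every $\gamma\in V$ and every $x\in\mathbb S^1$ the integral defining $F(\gamma)(x)$ converges absolutely; $f(\gamma)\in H^1$ for every $\gamma\in V$, with continuous representative $x\mapsto F(\gamma)(x)\nu(\gamma)(x)$; and the map $f\colon V\to H^1$ is of class $C^\infty$ (in the sense of Fréchet derivatives of all orders). -/

import Mathlib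

open MeasureTheory
open scoped ContDiff

noncomputable section

namespace Langmuir

/-- The plane `ℝ²` with its Euclidean norm. -/
abbrev Plane : Type := EuclideanSpace ℝ (Fin 2)

/-- The circle `𝕊¹ = ℝ/ℤ`. Its distance is the geodesic one, `min_k |x - y - k|`, and its
`volume` is the arc length, of total mass `1`. -/
abbrev Circ : Type := UnitAddCircle

/-- `L²(𝕊¹; ℝ²)`. -/
abbrev L2 : Type := Lp Plane 2 (volume : Measure Circ)

/-- Smooth test functions on the circle: the lift to `ℝ` is `C^∞`. -/
def IsTest (φ : Circ → ℝ) : Prop := ContDiff ℝ ∞ (fun t : ℝ => φ (t : Circ))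

/-- The derivative of a function on the circle. -/
def circDeriv (φ : Circ → ℝ) (x : Circ) : ℝ := deriv (fun t : ℝ => φ (x + (t : Circ))) 0

/-- `v` is the weak (distributional) derivative of `u` on the circle. -/
def IsWeakDeriv (u v : Circ → Plane) : Prop :=
  ∀ φ : Circ → ℝ, IsTest φ → (∫ x, circDeriv φ x • u x) = -(∫ x, φ x • v x)

theorem circDeriv_coe (φ : Circ → ℝ) (s : ℝ) :
    circDeriv φ (s : Circ) = deriv (fun t : ℝ => φ (t : Circ)) s := by
  have h : (fun t : ℝ => φ ((s : Circ) + (t : Circ))) =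
      fun t : ℝ => (fun r : ℝ => φ (r : Circ)) (s + t) := by
    funext t
    simp
  rw [circDeriv, h, deriv_comp_const_add (fun r : ℝ => φ (r : Circ)) s 0, add_zero]

theorem IsTest.continuous {φ : Circ → ℝ} (h : IsTest φ) : Continuous φ :=
  continuous_coinduced_dom.mpr (ContDiff.continuous h)

theorem IsTest.continuous_circDeriv {φ : Circ → ℝ} (h : IsTest φ) :
    Continuous (circDeriv φ) := by
  refine continuous_coinduced_dom.mpr ?_
  have h2 : (circDeriv φ ∘ fun t : ℝ => (t : Circ)) = deriv (fun t : ℝ => φ (t : Circ)) :=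
    funext fun s => circDeriv_coe φ s
  exact h2 ▸ ContDiff.continuous_deriv h (by simp)

theorem integrable_smul_L2 {ψ : Circ → ℝ} (hψ : Continuous ψ) (u : L2) :
    Integrable (fun x => ψ x • u x) volume := by
  have hu : Integrable (u : Circ → Plane) volume := (Lp.memLp u).integrable one_le_two
  obtain ⟨C, hC⟩ := (isCompact_range hψ).isBounded.exists_norm_le
  refine (hu.norm.const_mul C).mono' (hψ.aestronglyMeasurable.smul hu.aestronglyMeasurable) ?_
  refine Filter.Eventually.of_forall fun x => ?_
  rw [norm_smul]
  exact mul_le_mul_of_nonneg_right (hC (ψ x) (Set.mem_range_self x)) (norm_nonneg _)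

/-- The Sobolev space `H^k(𝕊¹; ℝ²)`. An element is an `L²` function `u 0` together with its weak
derivatives `u 1, …, u k` in `L²` (which are determined by `u 0`); the norm is
`(∑_{j ≤ k} ‖u j‖²_{L²})^{1/2}`. -/
def Sobolev (k : ℕ) : Submodule ℝ (PiLp 2 fun _ : Fin (k + 1) => L2) where
  carrier := {u | ∀ j : Fin k, IsWeakDeriv (u j.castSucc) (u j.succ)}
  zero_mem' := by
    intro j φ _
    have h0 : ((0 : L2) : Circ → Plane) =ᵐ[volume] 0 := Lp.coeFn_zero _ _ _
    have h1 : ∀ ψ : Circ → ℝ, (∫ x, ψ x • ((0 : L2) : Circ → Plane) x) = 0 := by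
      intro ψ
      refine integral_eq_zero_of_ae ?_
      filter_upwards [h0] with x hx
      rw [hx, Pi.zero_apply, smul_zero]

    have h2 := h1 (circDeriv φ)
    have h3 := h1 φ
    simp only [PiLp.zero_apply]
    rw [h2, h3, neg_zero]
  add_mem' := by
    intro u v hu hv j φ hφ
    have key : ∀ (ψ : Circ → ℝ), Continuous ψ → ∀ i : Fin (k + 1),
        (∫ x, ψ x • ((u + v) i : L2) x) = (∫ x, ψ x • u i x) + (∫ x, ψ x • v i x) := by
      intro ψ hψ i
      rw [← integral_add (integrable_smul_L2 hψ _) (integrable_smul_L2 hψ _)]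
      refine integral_congr_ae ?_
      filter_upwards [Lp.coeFn_add (u i) (v i)] with x hx
      rw [PiLp.add_apply, hx, Pi.add_apply, smul_add]
    rw [key _ hφ.continuous_circDeriv, key _ hφ.continuous, hu j φ hφ, hv j φ hφ, neg_add]
  smul_mem' := by
    intro c u hu j φ hφ
    have key : ∀ (ψ : Circ → ℝ) (i : Fin (k + 1)),
        (∫ x, ψ x • ((c • u) i : L2) x) = c • (∫ x, ψ x • u i x) := by
      intro ψ i
      rw [← integral_smul]
      refine integral_congr_ae ?_
      filter_upwards [Lp.coeFn_smul c (u i)] with x hx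
      rw [PiLp.smul_apply, hx, Pi.smul_apply, smul_comm]
    rw [key, key, hu j φ hφ, smul_neg]

open Classical in
/-- The continuous representative of an `L²` class. It is unique, and it exists for all the classes
used below by the Sobolev embedding `H¹ ⊂ C⁰`. -/
def contRep (u : L2) : Circ → Plane :=
  if h : ∃ g : Circ → Plane, Continuous g ∧ g =ᵐ[volume] u then h.choose else 0

/-- The value `γ(x)`. -/
def val {k : ℕ} (γ : Sobolev k) : Circ → Plane := contRep (γ.1 0)

/-- The first derivative `γ'(x)` of `γ ∈ H²`, as a continuous function. -/
def d1 (γ : Sobolev 2) : Circ → Plane := contRep (γ.1 1)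

/-- The second derivative `γ''(x)` of `γ ∈ H²`, defined almost everywhere. -/
def d2 (γ : Sobolev 2) : Circ → Plane := γ.1 2

/-- The chord-arc constant `|γ|_*`. -/
def chordArc (γ : Sobolev 2) : ℝ :=
  ⨅ p : {p : Circ × Circ // p.1 ≠ p.2}, ‖val γ p.1.1 - val γ p.1.2‖ / dist p.1.1 p.1.2

/-- The admissible set `V ⊂ H²`. -/
def V : Set (Sobolev 2) := {γ | 0 < chordArc γ}

/-- The unit tangent `τ(γ)`. -/
def tangent (γ : Sobolev 2) (x : Circ) : Plane := ‖d1 γ x‖⁻¹ • d1 γ x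

/-- The unit normal `ν(γ)`, the rotation of `τ(γ)` by the matrix with rows `(0, 1)`, `(-1, 0)`. -/
def normal (γ : Sobolev 2) (x : Circ) : Plane := !₂[tangent γ x 1, -tangent γ x 0]

/-- The curvature density `κ(γ)`. -/
def curvature (γ : Sobolev 2) (x : Circ) : ℝ := -inner ℝ (normal γ x) (d2 γ x) / ‖d1 γ x‖

/-- The chord `Δγ(x, y) = γ(y) - γ(x)`. -/
def chord (γ : Sobolev 2) (x y : Circ) : Plane := val γ y - val γ x

/-- The kernel `K(γ)(x, y)` for `x ≠ y`. -/
def kernel (γ : Sobolev 2) (x y : Circ) : ℝ :=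
  inner ℝ (normal γ x) (chord γ x y) * inner ℝ (normal γ y) (chord γ x y) / ‖chord γ x y‖ ^ 3

/-- The scalar nonlocal term `F(γ)`. -/
def nonlocalF (γ : Sobolev 2) (x : Circ) : ℝ :=
  -(1 / (2 * Real.pi)) * ∫ y, kernel γ x y * curvature γ y

/-- The forcing `f(γ) = F(γ) ν(γ)`, as a function on the circle. -/
def forcing (γ : Sobolev 2) (x : Circ) : Plane := nonlocalF γ x • normal γ x

end Langmuir

end

noncomputable section

namespace Langmuir

open Set Filter Topology
open scoped Interval ENNReal

/-! Write n for γ' rotated by the given matrix, Δ for the chord and d for the distance from x to y.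
The j-th coordinate of f(γ) is the y-integral of (1/2π) |γ'(x)|⁻² n_j(x) (n(x)·Δ)(n(y)·Δ) |Δ|⁻³
against a density that is linear in γ''(y). Because n(x)·γ'(x) = 0, n(x)·Δ = d² n(x)·β(x,y), where β
is the second order Taylor quotient `beta`; similarly n(y)·Δ = -d² n(y)·β(y,x). Hardy's inequality
(`lintegral_runAvg_sq_le`, `AvgDominated.lintegral_le`) bounds sup_x ∫ |β_i(x,y)|² dy by 4‖γ_i''‖²;
the same bound holds for the transposed kernel and for the quotient `eps` of γ'.

The x-derivative of the kernel, times the density, is therefore a finite sum of products of a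
bounded coefficient with three factors taken from γ''(x), γ''(y), β, its transpose and `eps`. The
coefficients are built from γ', Δ/d and their inverse norms. On V these norms are bounded below
(`d1_lower`, `chordD_lower`), so the coefficients are smooth maps into the Banach algebra `Bdd`; the
square root is handled by `contDiffAt_sqrtB`. The y-integral of such a product is an L² function of
x by duality: tested against φ(x), one factor times φ(x) is in L² of the torus, and so is the
product of the other two. The integral is thus a continuous multilinear expression in smooth data,
hence smooth in γ (`IsSmoothDensity.of_pairing`). This gives smooth L²-valued maps `forceL` and
`dforceL`.

That the second is the weak derivative of the first is `isWeakDerivReal_forceL`. The kernel is at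
most a constant times the integral of |γ''|² over the arc from x to y (`exists_kap_bound`), so it
vanishes on approach to the diagonal. For fixed y it is absolutely continuous in x away from y, so
integrating by parts on the circle cut at y leaves no boundary term, and Fubini concludes. Finally
`forceL` represents the pointwise forcing (`forceL_ae`), which is continuous by dominated
convergence. -/

/-! ### Absolutely continuous functions with a given almost everywhere derivative -/

/-- `f` is absolutely continuous between `a` and `b`, with derivative `g` almost everywhere. -/
structure HasACDeriv (f g : ℝ → ℝ) (a b : ℝ) : Prop where
  ac : AbsolutelyContinuousOnInterval f a b
  hasDerivAt : ∀ᵐ x, x ∈ uIcc a b → HasDerivAt f (g x) x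

namespace HasACDeriv

variable {f g f₁ g₁ : ℝ → ℝ} {a b : ℝ}

theorem integral_eq (h : HasACDeriv f g a b) : ∫ x in a..b, g x = f b - f a := by
  rw [← h.ac.integral_deriv_eq_sub]
  refine intervalIntegral.integral_congr_ae ?_
  filter_upwards [h.hasDerivAt] with x hx hx'
  exact (hx (uIoc_subset_uIcc hx')).deriv.symm

theorem continuousOn (h : HasACDeriv f g a b) : ContinuousOn f (uIcc a b) := h.ac.continuousOn

theorem add (h : HasACDeriv f g a b) (h₁ : HasACDeriv f₁ g₁ a b) :
    HasACDeriv (fun x => f x + f₁ x) (fun x => g x + g₁ x) a b :=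
  ⟨h.ac.add h₁.ac, by
    filter_upwards [h.hasDerivAt, h₁.hasDerivAt] with x hx hx₁ hm using (hx hm).add (hx₁ hm)⟩

theorem neg (h : HasACDeriv f g a b) : HasACDeriv (fun x => -f x) (fun x => -g x) a b :=
  ⟨h.ac.neg, by filter_upwards [h.hasDerivAt] with x hx hm using (hx hm).neg⟩

theorem sub (h : HasACDeriv f g a b) (h₁ : HasACDeriv f₁ g₁ a b) :
    HasACDeriv (fun x => f x - f₁ x) (fun x => g x - g₁ x) a b :=
  ⟨h.ac.sub h₁.ac, by
    filter_upwards [h.hasDerivAt, h₁.hasDerivAt] with x hx hx₁ hm using (hx hm).sub (hx₁ hm)⟩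

theorem mul (h : HasACDeriv f g a b) (h₁ : HasACDeriv f₁ g₁ a b) :
    HasACDeriv (fun x => f x * f₁ x) (fun x => g x * f₁ x + f x * g₁ x) a b :=
  ⟨h.ac.mul h₁.ac, by
    filter_upwards [h.hasDerivAt, h₁.hasDerivAt] with x hx hx₁ hm using (hx hm).mul (hx₁ hm)⟩

theorem const (c : ℝ) : HasACDeriv (fun _ => c) (fun _ => 0) a b :=
  ⟨(LipschitzWith.const c).lipschitzOnWith.absolutelyContinuousOnInterval,
    Eventually.of_forall fun x _ => hasDerivAt_const x c⟩

theorem congr_deriv (h : HasACDeriv f g a b) (hg : ∀ x ∈ uIcc a b, g x = g₁ x) :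
    HasACDeriv f g₁ a b :=
  ⟨h.ac, by filter_upwards [h.hasDerivAt] with x hx hm using hg x hm ▸ hx hm⟩

theorem of_integral (hg : IntervalIntegrable g volume a b)
    (hf : ∀ x, f x = f a + ∫ t in a..x, g t) : HasACDeriv f g a b := by
  have hac := ((LipschitzWith.const (β := ℝ) (f a)).lipschitzOnWith (s := uIcc a b)
    |>.absolutelyContinuousOnInterval).add
    (hg.absolutelyContinuousOnInterval_intervalIntegral left_mem_uIcc)
  have hfe : f = fun x => f a + ∫ t in a..x, g t := funext hf
  refine ⟨by rw [hfe]; exact hac, ?_⟩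
  filter_upwards [hg.ae_hasDerivAt_integral] with x hx hm
  rw [hfe]
  exact (hx hm a left_mem_uIcc).const_add (f a)

/-- By compactness `f` stays in a compact subinterval of (0, ∞), on which `φ` is Lipschitz, and a
Lipschitz function of an absolutely continuous one is absolutely continuous. This is what allows
negative powers of norms. -/
theorem comp_pos {φ φ' : ℝ → ℝ} (h : HasACDeriv f g a b) (hpos : ∀ x ∈ uIcc a b, 0 < f x)
    (hφ : ∀ y, 0 < y → HasDerivAt φ (φ' y) y) (hφ' : ContinuousOn φ' (Ioi 0)) :
    HasACDeriv (fun x => φ (f x)) (fun x => φ' (f x) * g x) a b := by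
  refine ⟨?_, ?_⟩
  swap
  · filter_upwards [h.hasDerivAt] with x hx hm
    exact (hφ _ (hpos x hm)).comp x (hx hm)
  obtain ⟨x₀, hx₀, hmin⟩ := isCompact_uIcc.exists_isMinOn nonempty_uIcc h.continuousOn
  obtain ⟨x₁, hx₁, hmax⟩ := isCompact_uIcc.exists_isMaxOn nonempty_uIcc h.continuousOn
  have hsub : Icc (f x₀) (f x₁) ⊆ Ioi 0 := fun y hy => (hpos x₀ hx₀).trans_le hy.1
  obtain ⟨C, hC⟩ := isCompact_Icc.exists_bound_of_continuousOn (hφ'.mono hsub)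
  have hlip : ∀ x ∈ uIcc a b, ∀ y ∈ uIcc a b,
      dist (φ (f x)) (φ (f y)) ≤ C * dist (f x) (f y) := by
    intro x hx y hy
    have := (convex_Icc (f x₀) (f x₁)).norm_image_sub_le_of_norm_hasDerivWithin_le
      (f := φ) (f' := φ') (C := C) (x := f y) (y := f x)
      (fun z hz => (hφ z (hsub hz)).hasDerivWithinAt) hC ⟨hmin hy, hmax hy⟩ ⟨hmin hx, hmax hx⟩
    simpa [dist_eq_norm] using this
  rw [AbsolutelyContinuousOnInterval] at *
  have hac : Tendsto (fun E : ℕ × (ℕ → ℝ × ℝ) => C * ∑ i ∈ Finset.range E.1,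
      dist (f (E.2 i).1) (f (E.2 i).2)) (AbsolutelyContinuousOnInterval.totalLengthFilter ⊓
        𝓟 (AbsolutelyContinuousOnInterval.disjWithin a b)) (𝓝 0) := by
    simpa using Tendsto.const_mul C h.ac
  refine squeeze_zero' (Eventually.of_forall fun E => Finset.sum_nonneg fun i _ => dist_nonneg)
    ?_ hac
  have : ∀ᶠ E in (AbsolutelyContinuousOnInterval.totalLengthFilter ⊓
        𝓟 (AbsolutelyContinuousOnInterval.disjWithin a b)),
      E ∈ AbsolutelyContinuousOnInterval.disjWithin a b :=
    mem_inf_of_right (mem_principal_self _)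
  filter_upwards [this] with E hE
  rw [Finset.mul_sum]
  exact Finset.sum_le_sum fun i hi => hlip _ (hE.1 i hi).1 _ (hE.1 i hi).2

theorem rpow_const (h : HasACDeriv f g a b) (hpos : ∀ x ∈ uIcc a b, 0 < f x) (p : ℝ) :
    HasACDeriv (fun x => f x ^ p) (fun x => p * f x ^ (p - 1) * g x) a b :=
  h.comp_pos (φ := fun y => y ^ p) (φ' := fun y => p * y ^ (p - 1)) hpos
    (fun _ hy => Real.hasDerivAt_rpow_const (Or.inl hy.ne'))
    (continuousOn_const.mul fun y hy =>
      (Real.continuousAt_rpow_const y _ (Or.inl (ne_of_gt hy))).continuousWithinAt)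

end HasACDeriv

/-! ### Functions on the circle and their lifts -/

theorem integrable_lift {g : Circ → ℝ} (hg : Integrable g) (a b : ℝ) :
    IntervalIntegrable (fun s : ℝ => g (s : Circ)) volume a b := by
  have hper : Function.Periodic (fun s : ℝ => g (s : Circ)) 1 := fun s => by simp
  refine hper.intervalIntegrable₀ one_ne_zero ?_ a b
  rw [intervalIntegrable_iff_integrableOn_Ioc_of_le zero_le_one]
  have := (UnitAddCircle.measurePreserving_mk 0).integrable_comp_of_integrable hg
  rw [zero_add] at this
  exact this

/-- Scalar weak derivatives on the circle. -/
def IsWeakDerivReal (u v : Circ → ℝ) : Prop :=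
  ∀ φ : Circ → ℝ, IsTest φ → (∫ x, circDeriv φ x * u x) = -(∫ x, φ x * v x)

/-- After subtraction of the mean all Fourier coefficients vanish, and the Fourier series converges
to the function in L². -/
theorem ae_eq_const_of_forall_fourier {u : Circ → ℝ} (hu : MemLp u 2)
    (h : ∀ n : ℤ, n ≠ 0 → ∫ x, fourier n x * (u x : ℂ) = 0) : ∃ c : ℝ, u =ᵐ[volume] fun _ => c := by
  have hvol : (volume : Measure Circ) = AddCircle.haarAddCircle := by
    rw [AddCircle.volume_eq_smul_haarAddCircle]; simp
  set c := ∫ x, u x with hc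
  have hw : MemLp (fun x => ((u x - c : ℝ) : ℂ)) 2 (AddCircle.haarAddCircle (T := 1)) := by
    rw [← hvol]
    exact (hu.sub (memLp_const c)).ofReal
  have hui : Integrable (fun x => (u x : ℂ)) := (hu.integrable one_le_two).ofReal
  have h0 : hw.toLp _ = 0 := by
    have hs := hasSum_fourier_series_L2 (hw.toLp _)
    have hz : ∀ n, fourierCoeff (hw.toLp _) n = 0 := by
      intro n
      rw [fourierCoeff_congr_ae hw.coeFn_toLp, fourierCoeff, ← hvol]
      have hi1 : Integrable (fun x : Circ => fourier (-n) x * (u x : ℂ)) := by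
        have := (hvol ▸ hui : Integrable _ AddCircle.haarAddCircle).fourier_smul (-n)
        rwa [← hvol] at this
      have hi2 : Integrable (fun x : Circ => fourier (-n) x * (c : ℂ)) := by
        have := (integrable_const (c : ℂ) :
          Integrable _ (AddCircle.haarAddCircle (T := 1))).fourier_smul (-n)
        rwa [← hvol] at this
      have : ∀ x : Circ, fourier (-n) x • ((u x - c : ℝ) : ℂ)
          = fourier (-n) x * (u x : ℂ) - fourier (-n) x * (c : ℂ) := by
        intro x; push_cast; rw [smul_eq_mul]; ring
      simp_rw [this]
      rw [integral_sub hi1 hi2]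
      by_cases hn : n = 0
      · subst hn
        have hone : (volume : Measure Circ).real univ = 1 := by simp [Measure.real]
        simp [hc, integral_complex_ofReal, hone]
      · rw [h (-n) (neg_ne_zero.mpr hn), integral_mul_const, zero_sub, neg_eq_zero]
        have := fourierCoeff_fourier (T := 1) (0 : ℤ)
        have h2 := congrFun this n
        rw [fourierCoeff, ← hvol] at h2
        simp only [fourier_zero, smul_eq_mul, mul_one] at h2
        rw [h2]
        simp [hn]
    simp_rw [hz, zero_smul] at hs
    exact hs.unique hasSum_zero
  refine ⟨c, ?_⟩
  have h1 := hw.coeFn_toLp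
  rw [h0] at h1
  have h2 := Lp.coeFn_zero ℂ 2 (AddCircle.haarAddCircle (T := 1))
  rw [hvol]
  filter_upwards [h1, h2] with x hx hx2
  rw [hx2, Pi.zero_apply] at hx
  have : u x - c = 0 := by exact_mod_cast hx.symm
  linarith

theorem hasDerivAt_circDeriv {φ : Circ → ℝ} (h : IsTest φ) (s : ℝ) :
    HasDerivAt (fun t : ℝ => φ (t : Circ)) (circDeriv φ (s : Circ)) s := by
  rw [circDeriv_coe]
  exact (ContDiff.differentiable h (by simp)).differentiableAt.hasDerivAt

theorem isTest_clm_fourier (L : ℂ →L[ℝ] ℝ) (n : ℤ) : IsTest fun x => L (fourier n x) := by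
  unfold IsTest
  simp_rw [fourier_coe_apply]
  have h : ContDiff ℝ ∞ fun t : ℝ => (t : ℂ) := Complex.ofRealCLM.contDiff
  fun_prop

theorem circDeriv_clm_fourier (L : ℂ →L[ℝ] ℝ) (n : ℤ) (x : Circ) :
    circDeriv (fun x => L (fourier n x)) x = L (2 * Real.pi * Complex.I * n * fourier n x) := by
  induction x using QuotientAddGroup.induction_on with | H s => ?_
  rw [circDeriv_coe]
  have h := L.hasFDerivAt.comp_hasDerivAt s (hasDerivAt_fourier (1 : ℝ) n s)
  refine h.deriv.trans ?_
  simp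

/-- Real coordinates of the characters are test functions, and differentiating a character
multiplies it by 2πin, which is nonzero for n ≠ 0. -/
theorem ae_eq_const_of_forall_test {u : Circ → ℝ} (hu : MemLp u 2)
    (h : ∀ φ : Circ → ℝ, IsTest φ → ∫ x, circDeriv φ x * u x = 0) :
    ∃ c : ℝ, u =ᵐ[volume] fun _ => c := by
  refine ae_eq_const_of_forall_fourier hu fun n hn => ?_
  have hint : Integrable (fun x : Circ => fourier n x * (u x : ℂ)) := by
    have hui : Integrable (fun x => (u x : ℂ)) := (hu.integrable one_le_two).ofReal
    refine hui.bdd_mul (c := 1) (map_continuous (fourier n)).aestronglyMeasurable ?_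
    exact Eventually.of_forall fun x => by rw [fourier_apply, Circle.norm_coe]
  set J := ∫ x, fourier n x * (u x : ℂ) with hJ
  -- Test functions are real valued, so the complex identity is obtained through real functionals;
  -- the real and imaginary parts suffice below.
  have key : ∀ L : ℂ →L[ℝ] ℝ, L (2 * Real.pi * Complex.I * n * J) = 0 := by
    intro L
    have h1 := h _ (isTest_clm_fourier L n)
    simp_rw [circDeriv_clm_fourier] at h1
    rw [hJ, ← integral_const_mul, ← L.integral_comp_comm (hint.const_mul _), ← h1]
    refine integral_congr_ae (Eventually.of_forall fun x => ?_)
    have : 2 * Real.pi * Complex.I * n * (fourier n x * (u x : ℂ))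
        = (u x) • (2 * Real.pi * Complex.I * n * fourier n x) := by
      rw [Complex.real_smul]; ring
    simp only [this, map_smul, smul_eq_mul]
    ring
  have hz : 2 * Real.pi * Complex.I * n * J = 0 :=
    Complex.ext (key Complex.reCLM) (key Complex.imCLM)
  have hne : (2 * Real.pi * Complex.I * n : ℂ) ≠ 0 := by
    simp [Real.pi_ne_zero, hn]
  exact (mul_eq_zero.mp hz).resolve_left hne

/-- An integrable function of mean zero on the circle has a continuous primitive. -/
theorem exists_primitive {v : Circ → ℝ} (hv : Integrable v) (h0 : ∫ x, v x = 0) :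
    ∃ W : Circ → ℝ, Continuous W ∧ ∀ s : ℝ, W (s : Circ) = ∫ t in (0 : ℝ)..s, v (t : Circ) := by
  have hi := integrable_lift hv
  -- The primitive descends to the circle exactly because `v` has mean zero.
  have hper : Function.Periodic (fun s : ℝ => ∫ t in (0 : ℝ)..s, v (t : Circ)) 1 := by
    intro s
    change ∫ t in (0 : ℝ)..(s + 1), v (t : Circ) = ∫ t in (0 : ℝ)..s, v (t : Circ)
    rw [← intervalIntegral.integral_add_adjacent_intervals (hi 0 s) (hi s (s + 1)),
      UnitAddCircle.intervalIntegral_preimage s v, h0, add_zero]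
  refine ⟨hper.lift, continuous_coinduced_dom.mpr ?_, fun s => hper.lift_coe s⟩
  exact intervalIntegral.continuous_primitive hi 0

/-- Integration by parts on [0, 1]; the boundary terms cancel by periodicity. -/
theorem integral_circDeriv_mul {v W φ : Circ → ℝ} (hv : Integrable v)
    (hW : ∀ a b : ℝ, W (b : Circ) - W (a : Circ) = ∫ t in a..b, v (t : Circ)) (hφ : IsTest φ) :
    (∫ x, circDeriv φ x * W x) = -(∫ x, φ x * v x) := by
  have hWc : Continuous W := by
    refine continuous_coinduced_dom.mpr ?_
    have : (W ∘ fun s : ℝ => (s : Circ)) = fun s : ℝ => W ((0 : ℝ) : Circ) +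
        ∫ t in (0 : ℝ)..s, v (t : Circ) := by
      funext s
      rw [← hW]; simp
    exact this ▸ (continuous_const.add (intervalIntegral.continuous_primitive (integrable_lift hv) 0))
  have hφc := hφ.continuous
  have h1 : HasACDeriv (fun s : ℝ => φ (s : Circ)) (fun s : ℝ => circDeriv φ (s : Circ)) 0 1 :=
    ⟨(ContDiff.of_le hφ (by simp)).contDiffOn.absolutelyContinuousOnInterval,
      Eventually.of_forall fun s _ => hasDerivAt_circDeriv hφ s⟩
  have h2 : HasACDeriv (fun s : ℝ => W (s : Circ)) (fun s : ℝ => v (s : Circ)) 0 1 :=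
    .of_integral (integrable_lift hv 0 1) fun x => by rw [← hW]; ring
  have h3 := (h1.mul h2).integral_eq
  have e1 : ((1 : ℝ) : Circ) = ((0 : ℝ) : Circ) := by
    rw [AddCircle.coe_period]; rfl
  rw [e1, sub_self] at h3
  have h4 := UnitAddCircle.intervalIntegral_preimage 0 fun x => circDeriv φ x * W x + φ x * v x
  rw [zero_add, h3] at h4
  obtain ⟨C, hC⟩ := (isCompact_range hφc).isBounded.exists_norm_le
  have i1 : Integrable (fun x => circDeriv φ x * W x) :=
    (hφ.continuous_circDeriv.mul hWc).integrable_of_hasCompactSupport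
      (HasCompactSupport.of_compactSpace _)
  have i2 : Integrable (fun x => φ x * v x) :=
    hv.bdd_mul hφc.aestronglyMeasurable (Eventually.of_forall fun x => hC _ ⟨x, rfl⟩)
  rw [integral_add i1 i2] at h4
  linarith

/-- One-dimensional Sobolev embedding on the circle. -/
theorem IsWeakDerivReal.exists_continuous {u v : Circ → ℝ} (hu : MemLp u 2) (hv : MemLp v 2)
    (h : IsWeakDerivReal u v) : ∃ w : Circ → ℝ, Continuous w ∧ w =ᵐ[volume] u ∧
      ∀ a b : ℝ, w (b : Circ) - w (a : Circ) = ∫ t in a..b, v (t : Circ) := by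
  have hvi := hv.integrable one_le_two
  -- Testing against the constant 1 forces a weak derivative to have mean zero.
  have h0 : ∫ x, v x = 0 := by
    have := h (fun _ => 1) contDiff_const
    have hd : ∀ x, circDeriv (fun _ : Circ => (1 : ℝ)) x = 0 := fun x => by simp [circDeriv]
    simp only [hd, zero_mul, integral_zero, one_mul] at this
    linarith
  obtain ⟨W, hWc, hW⟩ := exists_primitive hvi h0
  have hW' : ∀ a b : ℝ, W (b : Circ) - W (a : Circ) = ∫ t in a..b, v (t : Circ) := fun a b => by
    rw [hW, hW, intervalIntegral.integral_interval_sub_left (integrable_lift hvi _ _)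
      (integrable_lift hvi _ _)]
  have hWm : MemLp W 2 := hWc.memLp_of_hasCompactSupport (HasCompactSupport.of_compactSpace _)
  -- `u` and the primitive `W` have the same weak derivative, so they differ by a constant, which is
  -- then added to `W`.
  obtain ⟨c, hc⟩ := ae_eq_const_of_forall_test (hu.sub hWm) fun φ hφ => by
    have e1 := integral_circDeriv_mul hvi hW' hφ
    have e2 := h φ hφ
    obtain ⟨C, hC⟩ := (isCompact_range hφ.continuous_circDeriv).isBounded.exists_norm_le
    have i1 : ∀ {f : Circ → ℝ}, MemLp f 2 → Integrable (fun x => circDeriv φ x * f x) := fun hf =>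
      (hf.integrable one_le_two).bdd_mul hφ.continuous_circDeriv.aestronglyMeasurable
        (Eventually.of_forall fun x => hC _ ⟨x, rfl⟩)
    simp only [Pi.sub_apply, mul_sub]
    rw [integral_sub (i1 hu) (i1 hWm), e1, e2, sub_self]
  refine ⟨fun x => W x + c, hWc.add continuous_const, ?_, fun a b => ?_⟩
  · filter_upwards [hc] with x hx
    rw [← hx, Pi.sub_apply]; ring
  · rw [← hW' a b]; ring

/-! ### Hardy's inequality -/

theorem sq_lintegral_mul_le {α : Type*} [MeasurableSpace α] (μ : Measure α) {f g : α → ℝ≥0∞}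
    (hf : AEMeasurable f μ) (hg : AEMeasurable g μ) :
    (∫⁻ a, f a * g a ∂μ) ^ 2 ≤ (∫⁻ a, f a ^ 2 ∂μ) * ∫⁻ a, g a ^ 2 ∂μ := by
  have h := ENNReal.lintegral_mul_le_Lp_mul_Lq μ Real.HolderConjugate.two_two hf hg
  simp only [Pi.mul_apply] at h
  refine (pow_le_pow_left' h 2).trans_eq ?_
  rw [mul_pow, ← ENNReal.rpow_natCast, ← ENNReal.rpow_natCast, ← ENNReal.rpow_mul,
    ← ENNReal.rpow_mul]
  simp

theorem lintegral_Ioc_rpow {t : ℝ} (ht : 0 < t) :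
    ∫⁻ s in Ioc 0 t, ENNReal.ofReal (s ^ (-(1 / 2) : ℝ)) = ENNReal.ofReal (2 * t ^ (1 / 2 : ℝ)) := by
  have hi : IntegrableOn (fun s : ℝ => s ^ (-(1 / 2) : ℝ)) (Ioc 0 t) := by
    rw [← intervalIntegrable_iff_integrableOn_Ioc_of_le ht.le]
    exact intervalIntegral.intervalIntegrable_rpow' (by norm_num)
  rw [← ofReal_integral_eq_lintegral_ofReal hi, ← intervalIntegral.integral_of_le ht.le,
    integral_rpow (Or.inl (by norm_num))]
  · congr 1
    rw [Real.zero_rpow (by norm_num)]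
    norm_num
    ring
  · refine (ae_restrict_iff' measurableSet_Ioc).mpr (Eventually.of_forall fun s hs => ?_)
    exact Real.rpow_nonneg hs.1.le _

theorem lintegral_Ici_rpow {s : ℝ} (hs : 0 < s) :
    ∫⁻ t in Ici s, ENNReal.ofReal (t ^ (-(3 / 2) : ℝ)) = ENNReal.ofReal (2 * s ^ (-(1 / 2) : ℝ)) := by
  rw [setLIntegral_congr Ioi_ae_eq_Ici.symm,
    ← ofReal_integral_eq_lintegral_ofReal (integrableOn_Ioi_rpow_of_lt (by norm_num) hs),
    integral_Ioi_rpow_of_lt (by norm_num) hs]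
  · congr 1
    norm_num
    ring
  · refine (ae_restrict_iff' measurableSet_Ioi).mpr (Eventually.of_forall fun t ht => ?_)
    exact Real.rpow_nonneg (hs.le.trans (le_of_lt ht)) _

/-- The running average of a nonnegative function. -/
def runAvg (h : ℝ → ℝ≥0∞) (t : ℝ) : ℝ≥0∞ := ENNReal.ofReal t⁻¹ * ∫⁻ s in Ioc 0 t, h s

/-- Cauchy–Schwarz with h = s^(-1/4) · (s^(1/4) h). The weight is chosen so that, once the order of
integration is exchanged, the integral in t cancels the factor s^(1/2). -/
theorem runAvg_sq_le {h : ℝ → ℝ≥0∞} (hm : Measurable h) {t : ℝ} (ht : 0 < t) :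
    runAvg h t ^ 2 ≤ ∫⁻ s in Ioc 0 t,
      ENNReal.ofReal (2 * t ^ (-(3 / 2) : ℝ)) * (ENNReal.ofReal (s ^ (1 / 2 : ℝ)) * h s ^ 2) := by
  have hcs := sq_lintegral_mul_le (volume.restrict (Ioc 0 t))
    (f := fun s => ENNReal.ofReal (s ^ (-(1 / 4) : ℝ)))
    (g := fun s => ENNReal.ofReal (s ^ (1 / 4 : ℝ)) * h s) (by fun_prop) (by fun_prop)
  have e1 : ∫⁻ s in Ioc 0 t, ENNReal.ofReal (s ^ (-(1 / 4) : ℝ)) *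
      (ENNReal.ofReal (s ^ (1 / 4 : ℝ)) * h s) = ∫⁻ s in Ioc 0 t, h s := by
    refine setLIntegral_congr_fun measurableSet_Ioc fun s hs => ?_
    rw [← mul_assoc, ← ENNReal.ofReal_mul (Real.rpow_nonneg hs.1.le _), ← Real.rpow_add hs.1]
    norm_num
  have e2 : ∫⁻ s in Ioc 0 t, ENNReal.ofReal (s ^ (-(1 / 4) : ℝ)) ^ 2 =
      ENNReal.ofReal (2 * t ^ (1 / 2 : ℝ)) := by
    rw [← lintegral_Ioc_rpow ht]
    refine setLIntegral_congr_fun measurableSet_Ioc fun s hs => ?_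
    rw [← ENNReal.ofReal_pow (Real.rpow_nonneg hs.1.le _), ← Real.rpow_natCast,
      ← Real.rpow_mul hs.1.le]
    norm_num
  have e3 : ∫⁻ s in Ioc 0 t, (ENNReal.ofReal (s ^ (1 / 4 : ℝ)) * h s) ^ 2 =
      ∫⁻ s in Ioc 0 t, ENNReal.ofReal (s ^ (1 / 2 : ℝ)) * h s ^ 2 := by
    refine setLIntegral_congr_fun measurableSet_Ioc fun s hs => ?_
    rw [mul_pow, ← ENNReal.ofReal_pow (Real.rpow_nonneg hs.1.le _), ← Real.rpow_natCast,
      ← Real.rpow_mul hs.1.le]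
    norm_num
  rw [e1, e2, e3] at hcs
  rw [runAvg, mul_pow, lintegral_const_mul _ (by fun_prop)]
  calc _ ≤ ENNReal.ofReal t⁻¹ ^ 2 * (ENNReal.ofReal (2 * t ^ (1 / 2 : ℝ)) *
        ∫⁻ s in Ioc 0 t, ENNReal.ofReal (s ^ (1 / 2 : ℝ)) * h s ^ 2) := by gcongr
    _ = _ := by
      rw [← mul_assoc, ← ENNReal.ofReal_pow (by positivity), ← ENNReal.ofReal_mul (by positivity)]
      congr 2
      rw [mul_left_comm, ← Real.rpow_neg_one, ← Real.rpow_natCast, ← Real.rpow_mul ht.le,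
        ← Real.rpow_add ht]
      norm_num

/-- **Hardy's inequality** for the running average, in `L²`. -/
theorem lintegral_runAvg_sq_le {h : ℝ → ℝ≥0∞} (hm : Measurable h) (c : ℝ) :
    ∫⁻ t in Ioc 0 c, runAvg h t ^ 2 ≤ 4 * ∫⁻ s in Ioc 0 c, h s ^ 2 := by
  -- The indicator of s ≤ t turns the triangle into a square, where Tonelli applies directly.
  set F : ℝ → ℝ → ℝ≥0∞ := fun t s => ({p : ℝ × ℝ | p.2 ≤ p.1}).indicator (fun p =>
    ENNReal.ofReal (2 * p.1 ^ (-(3 / 2) : ℝ)) * (ENNReal.ofReal (p.2 ^ (1 / 2 : ℝ)) * h p.2 ^ 2)) (t, s)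
    with hF
  have hFm : Measurable (Function.uncurry F) :=
    Measurable.indicator (by fun_prop) (measurableSet_le measurable_snd measurable_fst)
  calc ∫⁻ t in Ioc 0 c, runAvg h t ^ 2 ≤ ∫⁻ t in Ioc 0 c, ∫⁻ s in Ioc 0 c, F t s := by
        refine setLIntegral_mono' measurableSet_Ioc fun t ht => (runAvg_sq_le hm ht.1).trans ?_
        calc _ = ∫⁻ s in Ioc 0 t, F t s := by
              refine setLIntegral_congr_fun measurableSet_Ioc fun s hs => ?_
              simp only [hF]
              rw [indicator_of_mem (show (t, s) ∈ {p : ℝ × ℝ | p.2 ≤ p.1} from hs.2)]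
          _ ≤ _ := lintegral_mono_set (Ioc_subset_Ioc_right ht.2)
    _ = ∫⁻ s in Ioc 0 c, ∫⁻ t in Ioc 0 c, F t s := by
        rw [lintegral_lintegral_swap hFm.aemeasurable]
    _ ≤ ∫⁻ s in Ioc 0 c, 4 * h s ^ 2 := by
        refine setLIntegral_mono' measurableSet_Ioc fun s hs => ?_
        calc ∫⁻ t in Ioc 0 c, F t s ≤ ∫⁻ t, (Ici s).indicator (fun t =>
              ENNReal.ofReal (2 * t ^ (-(3 / 2) : ℝ)) *
                (ENNReal.ofReal (s ^ (1 / 2 : ℝ)) * h s ^ 2)) t := by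
              refine (setLIntegral_le_lintegral _ _).trans (lintegral_mono fun t => ?_)
              by_cases hst : s ≤ t
              · simp [hF, hst]
              · simp [hF, hst]
          _ = 2 * (∫⁻ t in Ici s, ENNReal.ofReal (t ^ (-(3 / 2) : ℝ))) *
                (ENNReal.ofReal (s ^ (1 / 2 : ℝ)) * h s ^ 2) := by
              rw [lintegral_indicator measurableSet_Ici, lintegral_mul_const _ (by fun_prop)]
              congr 1
              rw [← lintegral_const_mul _ (by fun_prop)]
              refine lintegral_congr fun t => ?_
              rw [ENNReal.ofReal_mul (by norm_num)]
              simp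
          -- One factor 2 comes from the Cauchy–Schwarz step, the other from the integral of
          -- t^(-3/2) over [s, ∞).
          _ = 4 * h s ^ 2 := by
              rw [lintegral_Ici_rpow hs.1, ← mul_assoc]
              congr 1
              rw [mul_assoc, ← ENNReal.ofReal_mul (by have := hs.1; positivity), mul_assoc,
                ← Real.rpow_add hs.1]
              norm_num
    _ = _ := lintegral_const_mul _ (by fun_prop)

/-! ### Coordinates of Sobolev functions -/

/-- `L²(𝕊¹; ℝ)`. -/
abbrev L2r : Type := Lp ℝ 2 (volume : Measure Circ)

/-- A coordinate of a plane-valued `L²` function. -/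
def coordL (i : Fin 2) : L2 →L[ℝ] L2r := (EuclideanSpace.proj i : Plane →L[ℝ] ℝ).compLpL 2 volume

theorem coordL_ae (i : Fin 2) (u : L2) : coordL i u =ᵐ[volume] fun x => u x i :=
  ContinuousLinearMap.coeFn_compLpL _ u

/-- A coordinate of a derivative of a Sobolev function. -/
def cls {k : ℕ} (j : Fin (k + 1)) (i : Fin 2) : Sobolev k →L[ℝ] L2r :=
  coordL i ∘L PiLp.proj 2 (fun _ : Fin (k + 1) => L2) j ∘L (Sobolev k).subtypeL

theorem cls_ae {k : ℕ} (j : Fin (k + 1)) (i : Fin 2) (γ : Sobolev k) :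
    cls j i γ =ᵐ[volume] fun x => (γ.1 j : Circ → Plane) x i := coordL_ae i _

theorem integral_smul_coord {ψ : Circ → ℝ} (hψ : Continuous ψ) (u : L2) (i : Fin 2) :
    (∫ x, ψ x • u x) i = ∫ x, ψ x * coordL i u x := by
  have h := (EuclideanSpace.proj i : Plane →L[ℝ] ℝ).integral_comp_comm (integrable_smul_L2 hψ u)
  refine h.symm.trans (integral_congr_ae ?_)
  filter_upwards [coordL_ae i u] with x hx
  rw [hx]
  simp

theorem isWeakDeriv_iff {u v : L2} :
    IsWeakDeriv u v ↔ ∀ i, IsWeakDerivReal (coordL i u) (coordL i v) := by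
  constructor
  · intro h i φ hφ
    rw [← integral_smul_coord hφ.continuous_circDeriv, ← integral_smul_coord hφ.continuous, h φ hφ]
    simp
  · intro h φ hφ
    ext i
    have := h i φ hφ
    rw [← integral_smul_coord hφ.continuous_circDeriv, ← integral_smul_coord hφ.continuous] at this
    simpa using this

/-- The measure charges every nonempty open set, so two continuous functions that agree almost
everywhere are equal and the choice made in `contRep` is immaterial. -/
theorem contRep_eq {u : L2} {g : Circ → Plane} (hg : Continuous g) (h : g =ᵐ[volume] u) :
    contRep u = g := by
  have hex : ∃ g : Circ → Plane, Continuous g ∧ g =ᵐ[volume] u := ⟨g, hg, h⟩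
  rw [contRep, dif_pos hex]
  exact (Continuous.ae_eq_iff_eq volume hex.choose_spec.1 hg).mp (hex.choose_spec.2.trans h.symm)

theorem exists_contRep {u v : L2} (h : IsWeakDeriv u v) :
    Continuous (contRep u) ∧ contRep u =ᵐ[volume] u ∧ ∀ (i : Fin 2) (a b : ℝ),
      contRep u (b : Circ) i - contRep u (a : Circ) i = ∫ t in a..b, coordL i v (t : Circ) := by
  have h' := isWeakDeriv_iff.mp h
  choose w hwc hwu hw using fun i => (h' i).exists_continuous (Lp.memLp _) (Lp.memLp _)
  have hg : Continuous fun x => (WithLp.toLp 2 fun i => w i x : Plane) :=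
    (PiLp.continuous_toLp 2 _).comp (continuous_pi hwc)
  have hgu : (fun x => (WithLp.toLp 2 fun i => w i x : Plane)) =ᵐ[volume] u := by
    have : ∀ᵐ x, ∀ i, w i x = u x i := by
      rw [ae_all_iff]
      intro i
      filter_upwards [hwu i, coordL_ae i u] with x h1 h2
      rw [h1, h2]
    filter_upwards [this] with x hx
    ext i
    exact hx i
  rw [contRep_eq hg hgu]
  exact ⟨hg, hgu, fun i a b => hw i a b⟩

section Curve

variable (γ η : Sobolev 2)

theorem isWeakDeriv_val : IsWeakDeriv (γ.1 0) (γ.1 1) := γ.2 0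

theorem isWeakDeriv_d1 : IsWeakDeriv (γ.1 1) (γ.1 2) := γ.2 1

theorem continuous_val : Continuous (val γ) := (exists_contRep (isWeakDeriv_val γ)).1

theorem continuous_d1 : Continuous (d1 γ) := (exists_contRep (isWeakDeriv_d1 γ)).1

theorem val_ae : val γ =ᵐ[volume] γ.1 0 := (exists_contRep (isWeakDeriv_val γ)).2.1

theorem d1_ae : d1 γ =ᵐ[volume] γ.1 1 := (exists_contRep (isWeakDeriv_d1 γ)).2.1

theorem d1_sub (i : Fin 2) (a b : ℝ) :
    d1 γ (b : Circ) i - d1 γ (a : Circ) i = ∫ t in a..b, cls 2 i γ (t : Circ) :=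
  (exists_contRep (isWeakDeriv_d1 γ)).2.2 i a b

theorem ae_lift {p : Circ → Prop} (h : ∀ᵐ x, p x) : ∀ᵐ s : ℝ, p (s : Circ) := by
  have hn : ∀ n : ℤ, ∀ᵐ s ∂(volume.restrict (Ioc (n : ℝ) (n + 1))), p ((s : ℝ) : Circ) := fun n =>
    (UnitAddCircle.measurePreserving_mk (n : ℝ)).quasiMeasurePreserving.ae h
  have hn' : ∀ᵐ s : ℝ, ∀ n : ℤ, s ∈ Ioc (n : ℝ) (n + 1) → p (s : Circ) := by
    rw [ae_all_iff]
    exact fun n => (ae_restrict_iff' measurableSet_Ioc).mp (hn n)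
  filter_upwards [hn'] with s hs
  -- The intervals are open on the left, so the one that contains s starts at ⌈s⌉ - 1 and not at
  -- ⌊s⌋.
  refine hs (⌈s⌉ - 1) ⟨?_, ?_⟩
  · push_cast; linarith [Int.ceil_lt_add_one s]
  · push_cast; linarith [Int.le_ceil s]

theorem val_sub (i : Fin 2) (a b : ℝ) :
    val γ (b : Circ) i - val γ (a : Circ) i = ∫ t in a..b, d1 γ (t : Circ) i := by
  refine ((exists_contRep (isWeakDeriv_val γ)).2.2 i a b).trans
    (intervalIntegral.integral_congr_ae ?_)
  have h : ∀ᵐ x, coordL i (γ.1 1) x = d1 γ x i := by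
    filter_upwards [coordL_ae i (γ.1 1), d1_ae γ] with x h1 h2
    rw [h1, h2]
  filter_upwards [ae_lift h] with s hs _ using hs

theorem val_add : val (γ + η) = val γ + val η := by
  refine contRep_eq ((continuous_val γ).add (continuous_val η)) ?_
  filter_upwards [val_ae γ, val_ae η, Lp.coeFn_add (γ.1 0) (η.1 0)] with x h1 h2 h3
  rw [Pi.add_apply, h1, h2]
  exact h3.symm

theorem d1_add : d1 (γ + η) = d1 γ + d1 η := by
  refine contRep_eq ((continuous_d1 γ).add (continuous_d1 η)) ?_
  filter_upwards [d1_ae γ, d1_ae η, Lp.coeFn_add (γ.1 1) (η.1 1)] with x h1 h2 h3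
  rw [Pi.add_apply, h1, h2]
  exact h3.symm

theorem val_smul (c : ℝ) : val (c • γ) = c • val γ := by
  refine contRep_eq ((continuous_val γ).const_smul c) ?_
  filter_upwards [val_ae γ, Lp.coeFn_smul c (γ.1 0)] with x h1 h3
  rw [Pi.smul_apply, h1]
  exact h3.symm

theorem d1_smul (c : ℝ) : d1 (c • γ) = c • d1 γ := by
  refine contRep_eq ((continuous_d1 γ).const_smul c) ?_
  filter_upwards [d1_ae γ, Lp.coeFn_smul c (γ.1 1)] with x h1 h3
  rw [Pi.smul_apply, h1]
  exact h3.symm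

end Curve

/-! ### Uniform bounds from L² bounds on a function and its derivative. -/

instance : IsProbabilityMeasure (volume : Measure Circ) := ⟨UnitAddCircle.measure_univ⟩

theorem lintegral_enorm_le_norm (u : L2r) : ∫⁻ x, ‖u x‖ₑ ≤ ENNReal.ofReal ‖u‖ := by
  have h1 := eLpNorm_le_eLpNorm_of_exponent_le (μ := (volume : Measure Circ)) one_le_two
    (Lp.aestronglyMeasurable u)
  rw [eLpNorm_one_eq_lintegral_enorm] at h1
  rwa [Lp.norm_def, ENNReal.ofReal_toReal (Lp.eLpNorm_ne_top u)]

theorem integral_abs_le_norm (u : L2r) : ∫ x, |u x| ≤ ‖u‖ := by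
  have h := lintegral_enorm_le_norm u
  have : ∫ x, |u x| = (∫⁻ x, ‖u x‖ₑ).toReal := by
    rw [← integral_norm_eq_lintegral_enorm (Lp.aestronglyMeasurable u)]
    rfl
  rw [this]
  exact ENNReal.toReal_le_of_le_ofReal (norm_nonneg _) h

/-- The oscillation of `w` is at most the L¹ norm of `v`, hence at most its L² norm since the circle
has mass 1. Averaging |w(x)| ≤ |w(y)| + ‖v‖ over y gives the claim. It makes evaluation of γ'
bounded in the H² norm. -/
theorem abs_le_of_primitive {w : Circ → ℝ} {u v : L2r} (hu : w =ᵐ[volume] u)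
    (h : ∀ a b : ℝ, w (b : Circ) - w (a : Circ) = ∫ t in a..b, v (t : Circ)) (x : Circ) :
    |w x| ≤ ‖u‖ + ‖v‖ := by
  have hvi : Integrable (v : Circ → ℝ) := (Lp.memLp v).integrable one_le_two
  have hui : Integrable (u : Circ → ℝ) := (Lp.memLp u).integrable one_le_two
  induction x using QuotientAddGroup.induction_on with | H s => ?_
  have hy : ∀ y : Circ, |w (s : Circ)| ≤ |w y| + ‖v‖ := by
    intro y
    obtain ⟨t, ht, rfl⟩ : ∃ t ∈ Ioc s (s + 1), (t : Circ) = y := by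
      have : y ∈ ((↑) : ℝ → Circ) '' Ioc s (s + 1) := by
        rw [AddCircle.coe_image_Ioc_eq]; trivial
      exact this
    have h1 : |w (t : Circ) - w (s : Circ)| ≤ ‖v‖ := by
      rw [h]
      refine (intervalIntegral.abs_integral_le_integral_abs ht.1.le).trans ?_
      refine (intervalIntegral.integral_mono_interval le_rfl ht.1.le ht.2
        (Eventually.of_forall fun _ => abs_nonneg _) (integrable_lift hvi.abs _ _)).trans ?_
      rw [UnitAddCircle.intervalIntegral_preimage s fun x => |v x|]
      exact integral_abs_le_norm v
    have := abs_sub_abs_le_abs_sub (w (s : Circ)) (w (t : Circ))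
    rw [abs_sub_comm] at h1
    linarith
  have hi : ∫ y : Circ, |w (s : Circ)| ≤ ∫ y : Circ, (|w y| + ‖v‖) :=
    integral_mono (integrable_const _)
      ((hui.abs.congr (by filter_upwards [hu] with x hx; rw [hx])).add (integrable_const _)) hy
  have hone : (volume : Measure Circ).real univ = 1 := by simp [Measure.real]
  rw [integral_add (hui.abs.congr (by filter_upwards [hu] with x hx; rw [hx]))
    (integrable_const _)] at hi
  have : ∫ y, |w y| = ∫ y, |u y| := integral_congr_ae (by filter_upwards [hu] with x hx; rw [hx])
  simp only [integral_const, hone, one_smul, this] at hi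
  exact hi.trans (by linarith [integral_abs_le_norm u])

theorem abs_d1_le (γ : Sobolev 2) (i : Fin 2) (x : Circ) :
    |d1 γ x i| ≤ ‖cls 1 i γ‖ + ‖cls 2 i γ‖ :=
  abs_le_of_primitive (w := fun x => d1 γ x i)
    (by filter_upwards [d1_ae γ, cls_ae 1 i γ] with x h1 h2; rw [h1, h2]) (d1_sub γ i) x

/-! ### Signed distance and difference kernels -/

/-- The representative of `y - x` in `(-1/2, 1/2]`. -/
def sdist (x y : Circ) : ℝ := (AddCircle.measurableEquivIoc 1 (-1 / 2) (y - x) : ℝ)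

theorem measurable_sdist : Measurable fun p : Circ × Circ => sdist p.1 p.2 :=
  measurable_subtype_coe.comp ((AddCircle.measurableEquivIoc 1 (-1 / 2)).measurable.comp
    (measurable_snd.sub measurable_fst))

theorem sdist_coe {a b : ℝ} (h : b - a ∈ Ioc (-1 / 2 : ℝ) (1 / 2)) :
    sdist (a : Circ) (b : Circ) = b - a := by
  have h' : b - a ∈ Ioc (-1 / 2 : ℝ) (-1 / 2 + 1) := ⟨h.1, by linarith [h.2]⟩
  have := AddCircle.equivIoc_coe_eq (p := (1 : ℝ)) h'
  rw [sdist, ← AddCircle.coe_sub]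
  exact congrArg Subtype.val this

theorem dist_coe {a b : ℝ} (h : |b - a| ≤ 1 / 2) : dist (a : Circ) (b : Circ) = |b - a| := by
  rw [dist_comm, dist_eq_norm, ← AddCircle.coe_sub]
  exact (AddCircle.norm_coe_eq_abs_iff 1 one_ne_zero).mpr (by simpa using h)

/-- `b` is dominated by the averages of `|g|` over the arcs shorter than a half-circle. -/
def AvgDominated (b : Circ × Circ → ℝ) (g : Circ → ℝ) : Prop :=
  ∀ r s : ℝ, r < s → s < r + 1 / 2 →
    |b ((r : Circ), (s : Circ))| ≤ (s - r)⁻¹ * ∫ t in r..s, |g (t : Circ)| ∧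
    |b ((s : Circ), (r : Circ))| ≤ (s - r)⁻¹ * ∫ t in r..s, |g (t : Circ)|

theorem AvgDominated.swap {b : Circ × Circ → ℝ} {g : Circ → ℝ} (h : AvgDominated b g) :
    AvgDominated (fun p => b p.swap) g := fun r s h1 h2 => ⟨(h r s h1 h2).2, (h r s h1 h2).1⟩

theorem setLIntegral_Ioc_add (F : ℝ → ℝ≥0∞) (a c : ℝ) :
    ∫⁻ t in Ioc 0 c, F (a + t) = ∫⁻ s in Ioc a (a + c), F s := by
  have := (measurePreserving_add_left (volume : Measure ℝ) a).setLIntegral_comp_emb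
    (measurableEmbedding_addLeft a) F (Ioc 0 c)
  rwa [image_const_add_Ioc, add_zero] at this

theorem setLIntegral_Ioc_sub (F : ℝ → ℝ≥0∞) (a c : ℝ) :
    ∫⁻ t in Ioc 0 c, F (a - t) = ∫⁻ s in Ioc (a - c) a, F s := by
  have := (Measure.measurePreserving_sub_left (volume : Measure ℝ) a).setLIntegral_comp_emb
    (measurableEmbedding_subLeft a) F (Ioc 0 c)
  rwa [image_const_sub_Ioc, sub_zero, setLIntegral_congr Ico_ae_eq_Ioc] at this

/-- The two half-circles on either side of `a`, both parametrised by the distance to `a`, are where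
the one-sided Hardy inequality is used. -/
theorem circ_lintegral_split (F : Circ → ℝ≥0∞) (a : ℝ) :
    ∫⁻ y, F y = (∫⁻ t in Ioc 0 (1 / 2 : ℝ), F ((a + t : ℝ) : Circ)) +
      ∫⁻ t in Ioc 0 (1 / 2 : ℝ), F ((a - t : ℝ) : Circ) := by
  have h1 : ∫⁻ t in Ioc 0 (1 / 2 : ℝ), F ((a + t : ℝ) : Circ) =
      ∫⁻ s in Ioc a (a + 1 / 2), F (s : Circ) :=
    setLIntegral_Ioc_add (fun s : ℝ => F (s : Circ)) a _
  have h2 : ∫⁻ t in Ioc 0 (1 / 2 : ℝ), F ((a - t : ℝ) : Circ) =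
      ∫⁻ s in Ioc (a - 1 / 2) a, F (s : Circ) :=
    setLIntegral_Ioc_sub (fun s : ℝ => F (s : Circ)) a _
  rw [h1, h2, add_comm, ← lintegral_union measurableSet_Ioc, Ioc_union_Ioc_eq_Ioc,
    ← UnitAddCircle.lintegral_preimage (a - 1 / 2)]
  · congr 3; ring
  · linarith
  · linarith
  · exact Ioc_disjoint_Ioc_of_le le_rfl

theorem enorm_le_runAvg_add {c a t : ℝ} (ht : 0 < t) {g : Circ → ℝ} (hg : Integrable g)
    (h : |c| ≤ t⁻¹ * ∫ s in a..a + t, |g (s : Circ)|) :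
    ‖c‖ₑ ≤ runAvg (fun s => ‖g ((a + s : ℝ) : Circ)‖ₑ) t := by
  have h1 : ∫⁻ s in Ioc 0 t, ‖g ((a + s : ℝ) : Circ)‖ₑ =
      ∫⁻ s in Ioc a (a + t), ‖g (s : Circ)‖ₑ :=
    setLIntegral_Ioc_add (fun s : ℝ => ‖g (s : Circ)‖ₑ) a t
  have hi := (integrable_lift hg a (a + t)).1
  rw [runAvg, h1, ← ofReal_integral_norm_eq_lintegral_enorm hi,
    ← ENNReal.ofReal_mul (by positivity), ← intervalIntegral.integral_of_le (by linarith),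
    Real.enorm_eq_ofReal_abs]
  exact ENNReal.ofReal_le_ofReal h

theorem enorm_le_runAvg_sub {c a t : ℝ} (ht : 0 < t) {g : Circ → ℝ} (hg : Integrable g)
    (h : |c| ≤ t⁻¹ * ∫ s in a - t..a, |g (s : Circ)|) :
    ‖c‖ₑ ≤ runAvg (fun s => ‖g ((a - s : ℝ) : Circ)‖ₑ) t := by
  have h1 : ∫⁻ s in Ioc 0 t, ‖g ((a - s : ℝ) : Circ)‖ₑ =
      ∫⁻ s in Ioc (a - t) a, ‖g (s : Circ)‖ₑ :=
    setLIntegral_Ioc_sub (fun s : ℝ => ‖g (s : Circ)‖ₑ) a t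
  have hi := (integrable_lift hg (a - t) a).1
  rw [runAvg, h1, ← ofReal_integral_norm_eq_lintegral_enorm hi,
    ← ENNReal.ofReal_mul (by positivity), ← intervalIntegral.integral_of_le (by linarith),
    Real.enorm_eq_ofReal_abs]
  exact ENNReal.ofReal_le_ofReal h

/-- On each side of x the kernel is at most a running average, starting at x, of a translate or
reflection of |g|; Hardy's inequality applies to each, with a constant that does not depend on x. -/
theorem AvgDominated.lintegral_le {b : Circ × Circ → ℝ} {g : Circ → ℝ} (h : AvgDominated b g)
    (hg : Integrable g) (hgm : Measurable g) (x : Circ) :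
    ∫⁻ y, ‖b (x, y)‖ₑ ^ 2 ≤ 4 * ∫⁻ y, ‖g y‖ₑ ^ 2 := by
  induction x using QuotientAddGroup.induction_on with | H a => ?_
  have hco : Measurable fun s : ℝ => (s : Circ) := AddCircle.measurable_mk'
  rw [circ_lintegral_split _ a, circ_lintegral_split (fun y => ‖g y‖ₑ ^ 2) a, mul_add]
  refine add_le_add ?_ ?_
  · refine le_trans ?_ (lintegral_runAvg_sq_le
      (h := fun s => ‖g ((a + s : ℝ) : Circ)‖ₑ) (by fun_prop) (1 / 2))
    -- The antipodal point t = 1/2 is a null set and is dropped: `AvgDominated` says nothing there,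
    -- where the sign of `sdist` is only a convention.
    rw [setLIntegral_congr Ioo_ae_eq_Ioc.symm, setLIntegral_congr Ioo_ae_eq_Ioc.symm]
    refine setLIntegral_mono' measurableSet_Ioo fun t ht => pow_le_pow_left' ?_ 2
    refine enorm_le_runAvg_add ht.1 hg ?_
    have := (h a (a + t) (by linarith [ht.1]) (by linarith [ht.2])).1
    rwa [add_sub_cancel_left] at this
  · refine le_trans ?_ (lintegral_runAvg_sq_le
      (h := fun s => ‖g ((a - s : ℝ) : Circ)‖ₑ) (by fun_prop) (1 / 2))
    rw [setLIntegral_congr Ioo_ae_eq_Ioc.symm, setLIntegral_congr Ioo_ae_eq_Ioc.symm]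
    refine setLIntegral_mono' measurableSet_Ioo fun t ht => pow_le_pow_left' ?_ 2
    refine enorm_le_runAvg_sub ht.1 hg ?_
    have := (h (a - t) a (by linarith [ht.1]) (by linarith [ht.2])).2
    rwa [sub_sub_cancel] at this

/-- The second order difference quotient `(γ(y) - γ(x) - (y - x) γ'(x)) / |y - x|²`. -/
def beta (i : Fin 2) (γ : Sobolev 2) (p : Circ × Circ) : ℝ :=
  (val γ p.2 i - val γ p.1 i - sdist p.1 p.2 * d1 γ p.1 i) / dist p.1 p.2 ^ 2

/-- The difference quotient `(γ'(x) - γ'(y)) / |y - x|` of the derivative. -/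
def eps (i : Fin 2) (γ : Sobolev 2) (p : Circ × Circ) : ℝ :=
  (d1 γ p.1 i - d1 γ p.2 i) / dist p.1 p.2

theorem continuous_val_coord (γ : Sobolev 2) (i : Fin 2) : Continuous fun x => val γ x i :=
  (EuclideanSpace.proj i : Plane →L[ℝ] ℝ).continuous.comp (continuous_val γ)

theorem continuous_d1_coord (γ : Sobolev 2) (i : Fin 2) : Continuous fun x => d1 γ x i :=
  (EuclideanSpace.proj i : Plane →L[ℝ] ℝ).continuous.comp (continuous_d1 γ)

theorem measurable_beta (i : Fin 2) (γ : Sobolev 2) : Measurable (beta i γ) := by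
  have h1 := (continuous_val_coord γ i).measurable
  have h2 := (continuous_d1_coord γ i).measurable
  have h3 := measurable_sdist
  exact (((h1.comp measurable_snd).sub (h1.comp measurable_fst)).sub
    (h3.mul (h2.comp measurable_fst))).div ((measurable_fst.dist measurable_snd).pow_const 2)

theorem measurable_eps (i : Fin 2) (γ : Sobolev 2) : Measurable (eps i γ) := by
  have h2 := (continuous_d1_coord γ i).measurable
  exact ((h2.comp measurable_fst).sub (h2.comp measurable_snd)).div
    (measurable_fst.dist measurable_snd)

theorem integrable_cls {k : ℕ} (j : Fin (k + 1)) (i : Fin 2) (γ : Sobolev k) :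
    Integrable (cls j i γ : Circ → ℝ) := (Lp.memLp _).integrable one_le_two

theorem abs_d1_sub_le (γ : Sobolev 2) (i : Fin 2) {a b r s : ℝ} (hr : r ∈ Icc a b)
    (hs : s ∈ Icc a b) :
    |d1 γ (s : Circ) i - d1 γ (r : Circ) i| ≤ ∫ t in a..b, |cls 2 i γ (t : Circ)| := by
  have hi := integrable_lift (integrable_cls 2 i γ).abs
  wlog hrs : r ≤ s generalizing r s
  · rw [abs_sub_comm]
    exact this hs hr (le_of_not_ge hrs)
  rw [d1_sub]
  refine (intervalIntegral.abs_integral_le_integral_abs hrs).trans ?_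
  exact intervalIntegral.integral_mono_interval hr.1 hrs hs.2
    (Eventually.of_forall fun _ => abs_nonneg _) (hi _ _)

/-- The increment is the integral of γ', which differs from γ'(c) by at most the integral of |γ''|.
The base point `c` is left free so that both end points can serve. -/
theorem abs_taylor_le (γ : Sobolev 2) (i : Fin 2) {a b c : ℝ} (hab : a ≤ b) (hc : c ∈ Icc a b) :
    |val γ (b : Circ) i - val γ (a : Circ) i - (b - a) * d1 γ (c : Circ) i| ≤
      (b - a) * ∫ t in a..b, |cls 2 i γ (t : Circ)| := by
  have hcont : Continuous fun t : ℝ => d1 γ (t : Circ) i :=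
    (continuous_d1_coord γ i).comp (AddCircle.continuous_mk' 1)
  have h1 : val γ (b : Circ) i - val γ (a : Circ) i - (b - a) * d1 γ (c : Circ) i =
      ∫ t in a..b, (d1 γ (t : Circ) i - d1 γ (c : Circ) i) := by
    rw [intervalIntegral.integral_sub (hcont.intervalIntegrable _ _) (by simp), val_sub,
      intervalIntegral.integral_const, smul_eq_mul]
  rw [h1]
  have := intervalIntegral.norm_integral_le_of_norm_le_const (a := a) (b := b)
    (C := ∫ t in a..b, |cls 2 i γ (t : Circ)|)
    (f := fun t : ℝ => d1 γ (t : Circ) i - d1 γ (c : Circ) i) fun t ht => by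
      rw [uIoc_of_le hab] at ht
      exact abs_d1_sub_le γ i hc ⟨ht.1.le, ht.2⟩
  rw [abs_of_nonneg (sub_nonneg.mpr hab), mul_comm] at this
  exact this

theorem avgDominated_beta (i : Fin 2) (γ : Sobolev 2) : AvgDominated (beta i γ) (cls 2 i γ) := by
  intro r s hrs hs
  have hpos : 0 < s - r := sub_pos.mpr hrs
  have hd1 : dist (r : Circ) (s : Circ) = s - r := by
    rw [dist_coe, abs_of_pos hpos]; rw [abs_of_pos hpos]; linarith
  have key : ∀ {n : ℝ}, |n| ≤ (s - r) * ∫ t in r..s, |cls 2 i γ (t : Circ)| →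
      |n / (s - r) ^ 2| ≤ (s - r)⁻¹ * ∫ t in r..s, |cls 2 i γ (t : Circ)| := by
    intro n hn
    rw [abs_div, abs_of_pos (by positivity : 0 < (s - r) ^ 2), div_le_iff₀ (by positivity)]
    refine hn.trans_eq ?_
    field_simp
  constructor
  · simp only [beta]
    rw [sdist_coe ⟨by linarith, by linarith⟩, hd1]
    exact key (abs_taylor_le γ i hrs.le ⟨le_rfl, hrs.le⟩)
  · simp only [beta]
    rw [sdist_coe ⟨by linarith, by linarith⟩, dist_comm, hd1]
    -- With the points in reverse order the expansion is based at the right end, and the numerator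
    -- changes sign.
    refine key ?_
    rw [← abs_neg]
    convert abs_taylor_le γ i hrs.le ⟨hrs.le, le_rfl⟩ using 2
    ring

theorem avgDominated_eps (i : Fin 2) (γ : Sobolev 2) : AvgDominated (eps i γ) (cls 2 i γ) := by
  intro r s hrs hs
  have hpos : 0 < s - r := sub_pos.mpr hrs
  have hd1 : dist (r : Circ) (s : Circ) = s - r := by
    rw [dist_coe, abs_of_pos hpos]; rw [abs_of_pos hpos]; linarith
  have key : ∀ {n : ℝ}, |n| ≤ ∫ t in r..s, |cls 2 i γ (t : Circ)| →
      |n / (s - r)| ≤ (s - r)⁻¹ * ∫ t in r..s, |cls 2 i γ (t : Circ)| := by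
    intro n hn
    rw [abs_div, abs_of_pos hpos, div_eq_inv_mul]
    gcongr
  constructor
  · simp only [eps]
    rw [hd1]
    exact key (abs_d1_sub_le γ i ⟨hrs.le, le_rfl⟩ ⟨le_rfl, hrs.le⟩)
  · simp only [eps]
    rw [dist_comm, hd1]
    exact key (abs_d1_sub_le γ i ⟨le_rfl, hrs.le⟩ ⟨hrs.le, le_rfl⟩)

/-! ### Multiplication operators on the torus -/

/-- `L²(𝕊¹ × 𝕊¹; ℝ)`. -/
abbrev L2p : Type := Lp ℝ 2 (volume : Measure (Circ × Circ))

theorem eLpNorm_two_sq {α : Type*} [MeasurableSpace α] {μ : Measure α} (f : α → ℝ) :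
    eLpNorm f 2 μ ^ 2 = ∫⁻ x, ‖f x‖ₑ ^ 2 ∂μ := by
  have h := eLpNorm_nnreal_pow_eq_lintegral (f := f) (μ := μ) (p := 2) two_ne_zero
  simpa using h

theorem memLp_two_of_lintegral_le {α : Type*} [MeasurableSpace α] {μ : Measure α} {f : α → ℝ}
    (hf : AEStronglyMeasurable f μ) {K : ℝ} (h : ∫⁻ x, ‖f x‖ₑ ^ 2 ∂μ ≤ ENNReal.ofReal (K ^ 2)) :
    MemLp f 2 μ := by
  refine ⟨hf, ?_⟩
  by_contra hn
  rw [not_lt, top_le_iff] at hn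
  rw [← eLpNorm_two_sq, hn] at h
  simp at h

theorem norm_toLp_two_le {α : Type*} [MeasurableSpace α] {μ : Measure α} {f : α → ℝ}
    (hf : MemLp f 2 μ) {K : ℝ} (hK : 0 ≤ K)
    (h : ∫⁻ x, ‖f x‖ₑ ^ 2 ∂μ ≤ ENNReal.ofReal (K ^ 2)) : ‖hf.toLp f‖ ≤ K := by
  rw [Lp.norm_toLp]
  refine ENNReal.toReal_le_of_le_ofReal hK ?_
  rw [← eLpNorm_two_sq, ENNReal.ofReal_pow hK] at h
  exact (ENNReal.pow_right_strictMono two_ne_zero).le_iff_le.mp h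

theorem lintegral_sq_eq_norm {α : Type*} [MeasurableSpace α] {μ : Measure α} (f : Lp ℝ 2 μ) :
    ∫⁻ x, ‖f x‖ₑ ^ 2 ∂μ = ENNReal.ofReal (‖f‖ ^ 2) := by
  rw [← eLpNorm_two_sq, ENNReal.ofReal_pow (norm_nonneg _), Lp.norm_def,
    ENNReal.ofReal_toReal (Lp.eLpNorm_ne_top f)]

/-- A family of kernels on the torus depending linearly on a parameter, with
`sup_x ∫ |b(x, y)|² dy` controlled by the parameter. -/
structure KernelFamily (E : Type*) [NormedAddCommGroup E] [NormedSpace ℝ E] where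
  toFun : E → Circ × Circ → ℝ
  measurable : ∀ e, Measurable (toFun e)
  add : ∀ e e', ∀ᵐ p, toFun (e + e') p = toFun e p + toFun e' p
  smul : ∀ (c : ℝ) e, ∀ᵐ p, toFun (c • e) p = c * toFun e p
  bound : ℝ
  bound_nonneg : 0 ≤ bound
  lintegral_le : ∀ e x, ∫⁻ y, ‖toFun e (x, y)‖ₑ ^ 2 ≤ ENNReal.ofReal ((bound * ‖e‖) ^ 2)

namespace KernelFamily

variable {E : Type*} [NormedAddCommGroup E] [NormedSpace ℝ E] (B : KernelFamily E)

theorem measurable_mul_fst (e : E) (u : L2r) : Measurable fun p => B.toFun e p * u p.1 :=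
  (B.measurable e).mul ((Lp.stronglyMeasurable u).measurable.comp measurable_fst)

/-- As `u` depends on x alone, the inner integral in y sees only the kernel, whose bound is uniform
in x. -/
theorem lintegral_mul_fst_le (e : E) (u : L2r) :
    ∫⁻ p, ‖B.toFun e p * u p.1‖ₑ ^ 2 ≤ ENNReal.ofReal ((B.bound * ‖e‖ * ‖u‖) ^ 2) := by
  have hu := (Lp.stronglyMeasurable u).measurable
  have hB := B.measurable e
  rw [Measure.volume_eq_prod, lintegral_prod _
    (((B.measurable_mul_fst e u).enorm.pow_const 2).aemeasurable)]
  calc ∫⁻ x, ∫⁻ y, ‖B.toFun e (x, y) * u x‖ₑ ^ 2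
      = ∫⁻ x, (∫⁻ y, ‖B.toFun e (x, y)‖ₑ ^ 2) * ‖u x‖ₑ ^ 2 := by
        refine lintegral_congr fun x => ?_
        rw [← lintegral_mul_const _ (by fun_prop)]
        refine lintegral_congr fun y => ?_
        rw [enorm_mul, mul_pow]
    _ ≤ ∫⁻ x, ENNReal.ofReal ((B.bound * ‖e‖) ^ 2) * ‖u x‖ₑ ^ 2 := by
        gcongr with x
        exact B.lintegral_le e x
    _ = _ := by
        rw [lintegral_const_mul _ (by fun_prop), lintegral_sq_eq_norm,
          ← ENNReal.ofReal_mul (by positivity)]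
        congr 1; ring

theorem memLp_mul_fst (e : E) (u : L2r) : MemLp (fun p => B.toFun e p * u p.1) 2 volume :=
  memLp_two_of_lintegral_le (B.measurable_mul_fst e u).aestronglyMeasurable
    (B.lintegral_mul_fst_le e u)

theorem ae_fst {P : Circ → Prop} (h : ∀ᵐ x, P x) :
    ∀ᵐ p : Circ × Circ, P p.1 :=
  Measure.quasiMeasurePreserving_fst.ae h

theorem ae_snd {P : Circ → Prop} (h : ∀ᵐ x, P x) :
    ∀ᵐ p : Circ × Circ, P p.2 :=
  Measure.quasiMeasurePreserving_snd.ae h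

/-- The bilinear map `(e, u) ↦ b_e(x, y) u(x)`. -/
def lift : E →L[ℝ] L2r →L[ℝ] L2p :=
  LinearMap.mkContinuous₂
    (LinearMap.mk₂ ℝ (fun e u => (B.memLp_mul_fst e u).toLp)
      (fun e e' u => by
        rw [← MemLp.toLp_add]
        refine MemLp.toLp_congr _ _ ?_
        filter_upwards [B.add e e'] with p hp
        rw [hp, Pi.add_apply]; ring)
      (fun c e u => by
        rw [← MemLp.toLp_const_smul]
        refine MemLp.toLp_congr _ _ ?_
        filter_upwards [B.smul c e] with p hp
        rw [hp, Pi.smul_apply, smul_eq_mul]; ring)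
      (fun e u u' => by
        rw [← MemLp.toLp_add]
        refine MemLp.toLp_congr _ _ ?_
        filter_upwards [ae_fst (Lp.coeFn_add u u')] with p hp
        rw [hp, Pi.add_apply, Pi.add_apply]; ring)
      (fun c e u => by
        rw [← MemLp.toLp_const_smul]
        refine MemLp.toLp_congr _ _ ?_
        filter_upwards [ae_fst (Lp.coeFn_smul c u)] with p hp
        rw [hp, Pi.smul_apply, Pi.smul_apply, smul_eq_mul, smul_eq_mul]; ring))
    B.bound fun e u => norm_toLp_two_le (B.memLp_mul_fst e u)
      (mul_nonneg (mul_nonneg B.bound_nonneg (norm_nonneg _)) (norm_nonneg _))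
      (B.lintegral_mul_fst_le e u)

theorem lift_ae (e : E) (u : L2r) : B.lift e u =ᵐ[volume] fun p => B.toFun e p * u p.1 :=
  (B.memLp_mul_fst e u).coeFn_toLp

end KernelFamily

/-- The kernel family of a pointwise linear family of kernels dominated by averages of the second
derivative. -/
def KernelFamily.ofAvgDominated (i : Fin 2) (b : Sobolev 2 → Circ × Circ → ℝ)
    (hm : ∀ γ, Measurable (b γ)) (hadd : ∀ γ η p, b (γ + η) p = b γ p + b η p)
    (hsmul : ∀ (c : ℝ) γ p, b (c • γ) p = c * b γ p)
    (hdom : ∀ γ, AvgDominated (b γ) (cls 2 i γ)) : KernelFamily (Sobolev 2) where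
  toFun := b
  measurable := hm
  add e e' := Eventually.of_forall fun p => hadd e e' p
  smul c e := Eventually.of_forall fun p => hsmul c e p
  -- The 2 is the square root of Hardy's constant 4.
  bound := 2 * ‖(cls 2 i : Sobolev 2 →L[ℝ] L2r)‖
  bound_nonneg := by positivity
  lintegral_le γ x := by
    refine ((hdom γ).lintegral_le (integrable_cls 2 i γ)
      (Lp.stronglyMeasurable _).measurable x).trans ?_
    rw [lintegral_sq_eq_norm, show (4 : ℝ≥0∞) = ENNReal.ofReal 4 by simp,
      ← ENNReal.ofReal_mul (by norm_num)]
    refine ENNReal.ofReal_le_ofReal ?_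
    have h := (cls 2 i : Sobolev 2 →L[ℝ] L2r).le_opNorm γ
    have h0 := norm_nonneg (cls 2 i γ)
    nlinarith [mul_nonneg (norm_nonneg (cls 2 i : Sobolev 2 →L[ℝ] L2r)) (norm_nonneg γ)]

theorem beta_add (i : Fin 2) (γ η : Sobolev 2) (p : Circ × Circ) :
    beta i (γ + η) p = beta i γ p + beta i η p := by
  simp only [beta, val_add, d1_add, Pi.add_apply, PiLp.add_apply]
  ring

theorem beta_smul (i : Fin 2) (c : ℝ) (γ : Sobolev 2) (p : Circ × Circ) :
    beta i (c • γ) p = c * beta i γ p := by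
  simp only [beta, val_smul, d1_smul, Pi.smul_apply, PiLp.smul_apply, smul_eq_mul]
  ring

theorem eps_add (i : Fin 2) (γ η : Sobolev 2) (p : Circ × Circ) :
    eps i (γ + η) p = eps i γ p + eps i η p := by
  simp only [eps, d1_add, Pi.add_apply, PiLp.add_apply]
  ring

theorem eps_smul (i : Fin 2) (c : ℝ) (γ : Sobolev 2) (p : Circ × Circ) :
    eps i (c • γ) p = c * eps i γ p := by
  simp only [eps, d1_smul, Pi.smul_apply, PiLp.smul_apply, smul_eq_mul]
  ring

/-- The kernels `beta i`. -/
def betaK (i : Fin 2) : KernelFamily (Sobolev 2) :=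
  .ofAvgDominated i (beta i) (measurable_beta i) (beta_add i) (beta_smul i) (avgDominated_beta i)

/-- The transposed kernels of `beta i`. -/
def betaTK (i : Fin 2) : KernelFamily (Sobolev 2) :=
  .ofAvgDominated i (fun γ p => beta i γ p.swap) (fun γ => (measurable_beta i γ).comp measurable_swap)
    (fun γ η _ => beta_add i γ η _) (fun c γ _ => beta_smul i c γ _)
    (fun γ => (avgDominated_beta i γ).swap)

/-- The transposed kernels of `eps i`. -/
def epsTK (i : Fin 2) : KernelFamily (Sobolev 2) :=
  .ofAvgDominated i (fun γ p => eps i γ p.swap) (fun γ => (measurable_eps i γ).comp measurable_swap)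
    (fun γ η _ => eps_add i γ η _) (fun c γ _ => eps_smul i c γ _)
    (fun γ => (avgDominated_eps i γ).swap)

/-- The kernels `(x, y) ↦ κ(y)` for `κ ∈ L²`. -/
def sndK : KernelFamily L2r where
  toFun κ p := κ p.2
  measurable κ := (Lp.stronglyMeasurable κ).measurable.comp measurable_snd
  add κ κ' := KernelFamily.ae_snd (Lp.coeFn_add κ κ')
  smul c κ := KernelFamily.ae_snd (Lp.coeFn_smul c κ)
  bound := 1
  bound_nonneg := zero_le_one
  lintegral_le κ x := by rw [lintegral_sq_eq_norm, one_mul]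

/-- The isometry `w ↦ w ∘ swap` of `L²(𝕊¹ × 𝕊¹)`. -/
def swapL : L2p →L[ℝ] L2p :=
  (Lp.compMeasurePreservingₗᵢ ℝ Prod.swap Measure.measurePreserving_swap).toContinuousLinearMap

theorem swapL_ae (w : L2p) : swapL w =ᵐ[volume] fun p => w p.swap :=
  Lp.coeFn_compMeasurePreserving w Measure.measurePreserving_swap

/-- The set of pairs of distinct points. -/
abbrev OffDiag : Type := {p : Circ × Circ // p.1 ≠ p.2}

/-- Bounded continuous functions of two distinct points. -/
abbrev Bdd : Type := BoundedContinuousFunction OffDiag ℝ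

open Classical in
/-- Extension by zero to the diagonal. -/
def extend (a : Bdd) (p : Circ × Circ) : ℝ := if h : p.1 ≠ p.2 then a ⟨p, h⟩ else 0

theorem extend_of_ne (a : Bdd) {p : Circ × Circ} (h : p.1 ≠ p.2) : extend a p = a ⟨p, h⟩ :=
  dif_pos h

theorem abs_extend_le (a : Bdd) (p : Circ × Circ) : |extend a p| ≤ ‖a‖ := by
  rw [extend]
  split_ifs with h
  · exact a.norm_coe_le_norm ⟨p, h⟩
  · simp

theorem measurableSet_offDiag : MeasurableSet {p : Circ × Circ | p.1 ≠ p.2} :=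
  (isOpen_ne_fun continuous_fst continuous_snd).measurableSet

theorem measurable_extend (a : Bdd) : Measurable (extend a) := by
  classical
  have : extend a = fun p => if h : p ∈ {p : Circ × Circ | p.1 ≠ p.2} then a ⟨p, h⟩ else 0 := by
    funext p; simp only [extend]; rfl
  rw [this]
  exact Measurable.dite (f := fun p : {p : Circ × Circ | p.1 ≠ p.2} => a p) a.continuous.measurable
    (measurable_const (a := (0 : ℝ))) measurableSet_offDiag

theorem lintegral_extend_mul_le (a : Bdd) (w : L2p) :
    ∫⁻ p, ‖extend a p * w p‖ₑ ^ 2 ≤ ENNReal.ofReal ((‖a‖ * ‖w‖) ^ 2) := by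
  calc _ ≤ ∫⁻ p, ENNReal.ofReal (‖a‖ ^ 2) * ‖w p‖ₑ ^ 2 := by
        refine lintegral_mono fun p => ?_
        rw [enorm_mul, mul_pow, ENNReal.ofReal_pow (norm_nonneg _)]
        gcongr
        rw [Real.enorm_eq_ofReal_abs]
        exact ENNReal.ofReal_le_ofReal (abs_extend_le a p)
    _ = _ := by
        rw [lintegral_const_mul _ (by have := (Lp.stronglyMeasurable w).measurable; fun_prop),
          lintegral_sq_eq_norm, ← ENNReal.ofReal_mul (by positivity), mul_pow]

theorem memLp_extend_mul (a : Bdd) (w : L2p) : MemLp (fun p => extend a p * w p) 2 volume :=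
  memLp_two_of_lintegral_le
    ((measurable_extend a).mul (Lp.stronglyMeasurable w).measurable).aestronglyMeasurable
    (lintegral_extend_mul_le a w)

/-- Multiplication of `L²(𝕊¹ × 𝕊¹)` by bounded functions. -/
def mulBdd : Bdd →L[ℝ] L2p →L[ℝ] L2p :=
  LinearMap.mkContinuous₂
    (LinearMap.mk₂ ℝ (fun a w => (memLp_extend_mul a w).toLp)
      (fun a a' w => by
        rw [← MemLp.toLp_add]
        refine MemLp.toLp_congr _ _ (Eventually.of_forall fun p => ?_)
        simp only [extend, Pi.add_apply]
        split_ifs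
        · rw [BoundedContinuousFunction.add_apply]; ring
        · ring)
      (fun c a w => by
        rw [← MemLp.toLp_const_smul]
        refine MemLp.toLp_congr _ _ (Eventually.of_forall fun p => ?_)
        simp only [extend, Pi.smul_apply, smul_eq_mul]
        split_ifs
        · rw [BoundedContinuousFunction.smul_apply, smul_eq_mul]; ring
        · ring)
      (fun a w w' => by
        rw [← MemLp.toLp_add]
        refine MemLp.toLp_congr _ _ ?_
        filter_upwards [Lp.coeFn_add w w'] with p hp
        rw [hp, Pi.add_apply, Pi.add_apply]; ring)
      (fun c a w => by
        rw [← MemLp.toLp_const_smul]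
        refine MemLp.toLp_congr _ _ ?_
        filter_upwards [Lp.coeFn_smul c w] with p hp
        rw [hp, Pi.smul_apply, Pi.smul_apply, smul_eq_mul, smul_eq_mul]; ring))
    1 fun a w => norm_toLp_two_le (memLp_extend_mul a w) (by positivity)
      (by rw [one_mul]; exact lintegral_extend_mul_le a w)

theorem mulBdd_ae (a : Bdd) (w : L2p) : mulBdd a w =ᵐ[volume] fun p => extend a p * w p :=
  (memLp_extend_mul a w).coeFn_toLp

/-- Passage to the adjoint, as a continuous linear map. -/
def adjointL : (L2r →L[ℝ] L2p) →L[ℝ] L2p →L[ℝ] L2r :=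
  LinearMap.mkContinuous
    { toFun := fun A => ContinuousLinearMap.adjoint A
      map_add' := fun A A' => map_add _ A A'
      map_smul' := fun c A => by
        rw [map_smulₛₗ]; rfl }
    1 fun A => by
      rw [one_mul]
      exact (LinearIsometryEquiv.norm_map ContinuousLinearMap.adjoint A).le

theorem inner_adjointL (A : L2r →L[ℝ] L2p) (u : L2r) (w : L2p) :
    inner ℝ u (adjointL A w) = inner ℝ (A u) w :=
  ContinuousLinearMap.adjoint_inner_right A u w

/-- The element of `L²` pairing with functions `φ(x)` as `b_e(x, y) a(x, y) w(x, y)` does. -/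
def pairing {E : Type*} [NormedAddCommGroup E] [NormedSpace ℝ E] (B : KernelFamily E)
    (a : Bdd) (e : E) (w : L2p) : L2r := adjointL (B.lift e) (mulBdd a w)

theorem inner_pairing {E : Type*} [NormedAddCommGroup E] [NormedSpace ℝ E] (B : KernelFamily E)
    (a : Bdd) (e : E) (w : L2p) (u : L2r) :
    Integrable (fun p => B.toFun e p * u p.1 * (extend a p * w p)) ∧
    inner ℝ u (pairing B a e w) = ∫ p, B.toFun e p * u p.1 * (extend a p * w p) := by
  constructor
  · exact (B.memLp_mul_fst e u).integrable_mul (memLp_extend_mul a w)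
  · rw [pairing, inner_adjointL, L2.inner_def]
    refine integral_congr_ae ?_
    filter_upwards [B.lift_ae e u, mulBdd_ae a w] with p h1 h2
    rw [h1, h2, RCLike.inner_apply', RCLike.conj_to_real]

/-! ### Smooth maps into the algebra of bounded continuous functions -/

/-- A pointwise linear and bounded family of continuous functions, as a continuous linear map. -/
def bddOfLinear {E : Type*} [NormedAddCommGroup E] [NormedSpace ℝ E] (b : E → OffDiag → ℝ)
    (hc : ∀ e, Continuous (b e)) (hadd : ∀ e e' p, b (e + e') p = b e p + b e' p)
    (hsmul : ∀ (c : ℝ) e p, b (c • e) p = c * b e p) (M : ℝ) (hM : 0 ≤ M)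
    (hb : ∀ e p, |b e p| ≤ M * ‖e‖) : E →L[ℝ] Bdd :=
  LinearMap.mkContinuous
    { toFun := fun e => BoundedContinuousFunction.ofNormedAddCommGroup (b e) (hc e) (M * ‖e‖) (hb e)
      map_add' := fun e e' => by ext p; exact hadd e e' p
      map_smul' := fun c e => by ext p; exact hsmul c e p }
    M fun e => BoundedContinuousFunction.norm_ofNormedAddCommGroup_le _
      (mul_nonneg hM (norm_nonneg _)) (hb e)

section BddAlgebra

theorem isUnit_of_le {s : Bdd} {c : ℝ} (hc : 0 < c) (h : ∀ p, c ≤ s p) : IsUnit s := by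
  have hpos : ∀ p, 0 < s p := fun p => hc.trans_le (h p)
  refine IsUnit.of_mul_eq_one (BoundedContinuousFunction.ofNormedAddCommGroup (fun p => (s p)⁻¹)
    (s.continuous.inv₀ fun p => (hpos p).ne') c⁻¹ fun p => ?_) ?_
  · rw [Real.norm_of_nonneg (inv_nonneg.mpr (hpos p).le)]
    exact inv_anti₀ hc (h p)
  · ext p
    exact mul_inv_cancel₀ (hpos p).ne'

theorem ringInverse_apply {s : Bdd} (h : IsUnit s) (p : OffDiag) : Ring.inverse s p = (s p)⁻¹ := by
  have h1 : s p * Ring.inverse s p = 1 := congrArg (fun f : Bdd => f p) (Ring.mul_inverse_cancel s h)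
  exact eq_inv_of_mul_eq_one_right h1

/-- The pointwise square root. -/
def sqrtB (q : Bdd) : Bdd :=
  BoundedContinuousFunction.ofNormedAddCommGroup (fun p => √(q p)) q.continuous.sqrt √‖q‖
    fun p => by
      rw [Real.norm_of_nonneg (Real.sqrt_nonneg _)]
      exact Real.sqrt_le_sqrt ((le_abs_self _).trans (q.norm_coe_le_norm p))

/-- Inverse function theorem for x ↦ x² in the Banach algebra: its derivative at s = √q is
multiplication by 2s, invertible since s is bounded below, and the local inverse coincides with the
pointwise root. -/
theorem contDiffAt_sqrtB {q : Bdd} {c : ℝ} (hc : 0 < c) (h : ∀ p, c ≤ q p) :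
    ContDiffAt ℝ ∞ sqrtB q := by
  set s := sqrtB q with hs
  have hsc : ∀ p, √c ≤ s p := fun p => Real.sqrt_le_sqrt (h p)
  have hc' : 0 < √c := Real.sqrt_pos.mpr hc
  have hss : s * s = q := by
    ext p
    exact Real.mul_self_sqrt (hc.le.trans (h p))
  obtain ⟨u, hu⟩ := isUnit_of_le hc' hsc
  let f' : Bdd ≃L[ℝ] Bdd := ContinuousLinearEquiv.equivOfInverse
    ((2 : ℝ) • ContinuousLinearMap.mul ℝ Bdd s)
    ((2⁻¹ : ℝ) • ContinuousLinearMap.mul ℝ Bdd (↑u⁻¹ : Bdd))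
    (fun x => by simp [← hu]) (fun x => by simp [← hu])
  have hf : ContDiffAt ℝ ∞ (fun x : Bdd => x * x) s := by fun_prop
  have hf' : HasFDerivAt (fun x : Bdd => x * x) (f' : Bdd →L[ℝ] Bdd) s := by
    have := (hasFDerivAt_id s).mul' (hasFDerivAt_id (𝕜 := ℝ) s)
    refine this.congr_fderiv ?_
    ext x p
    simp [f', two_mul, mul_comm]
  have hst := hf.hasStrictFDerivAt' hf' (by simp)
  have hev : ∀ᶠ x in 𝓝 s, sqrtB (x * x) = x := by
    -- Since s ≥ √c everywhere, every x within √c of s in the uniform norm is still positive.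
    filter_upwards [Metric.ball_mem_nhds s hc'] with x hx
    ext p
    refine Real.sqrt_mul_self ?_
    have h1 : |x p - s p| ≤ dist x s := by
      rw [← Real.dist_eq]; exact BoundedContinuousFunction.dist_coe_le_dist p
    have := hsc p
    have := Metric.mem_ball.mp hx
    linarith [abs_le.mp h1]
  have huniq := hst.localInverse_unique hev
  have hinv := hf.to_localInverse hf' (by simp)
  simp only [hss] at hinv huniq
  exact hinv.congr_of_eventuallyEq huniq

/-- The pointwise inverse Euclidean norm. -/
def invNorm (a b : Bdd) : Bdd := Ring.inverse (sqrtB (a * a + b * b))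

theorem isUnit_sqrtB {q : Bdd} {c : ℝ} (hc : 0 < c) (h : ∀ p, c ≤ q p) : IsUnit (sqrtB q) :=
  isUnit_of_le (Real.sqrt_pos.mpr hc) fun p => Real.sqrt_le_sqrt (h p)

theorem invNorm_apply {a b : Bdd} {c : ℝ} (hc : 0 < c) (h : ∀ p, c ≤ a p ^ 2 + b p ^ 2)
    (p : OffDiag) : invNorm a b p = (√(a p ^ 2 + b p ^ 2))⁻¹ := by
  have h' : ∀ p, c ≤ (a * a + b * b) p := fun p => by
    have := h p
    simpa [sq] using this
  rw [invNorm, ringInverse_apply (isUnit_sqrtB hc h')]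
  simp [sqrtB, sq]

theorem contDiffOn_invNorm {E : Type*} [NormedAddCommGroup E] [NormedSpace ℝ E] {S : Set E}
    {a b : E → Bdd} (ha : ContDiffOn ℝ ∞ a S) (hb : ContDiffOn ℝ ∞ b S)
    (h : ∀ e ∈ S, ∃ c > 0, ∀ p, c ≤ a e p ^ 2 + b e p ^ 2) :
    ContDiffOn ℝ ∞ (fun e => invNorm (a e) (b e)) S := by
  intro e he
  obtain ⟨c, hc, hcp⟩ := h e he
  have h' : ∀ p, c ≤ (a e * a e + b e * b e) p := fun p => by
    have := hcp p
    simpa [sq] using this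
  have h1 : ContDiffWithinAt ℝ ∞ (fun e => a e * a e + b e * b e) S e :=
    (((ha e he).mul (ha e he)).add ((hb e he).mul (hb e he)))
  have h2 := (contDiffAt_sqrtB hc h').comp_contDiffWithinAt e h1
  obtain ⟨u, hu⟩ := isUnit_sqrtB hc h'
  have h3 : ContDiffAt ℝ ∞ Ring.inverse (sqrtB (a e * a e + b e * b e)) := by
    rw [← hu]; exact contDiffAt_ringInverse ℝ u
  exact h3.comp_contDiffWithinAt e h2

end BddAlgebra

/-! ### The chord-arc condition -/

/-- The tangent at the first point. -/
def tanX (i : Fin 2) : Sobolev 2 →L[ℝ] Bdd :=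
  bddOfLinear (fun γ p => d1 γ p.1.1 i)
    (fun γ => (continuous_d1_coord γ i).comp (continuous_fst.comp continuous_subtype_val))
    (fun γ η p => by simp [d1_add]) (fun c γ p => by simp [d1_smul])
    (‖(cls 1 i : Sobolev 2 →L[ℝ] L2r)‖ + ‖(cls 2 i : Sobolev 2 →L[ℝ] L2r)‖) (by positivity)
    fun γ p => (abs_d1_le γ i _).trans <| by
      rw [add_mul]
      exact add_le_add (ContinuousLinearMap.le_opNorm _ _) (ContinuousLinearMap.le_opNorm _ _)

/-- The tangent at the second point. -/
def tanY (i : Fin 2) : Sobolev 2 →L[ℝ] Bdd :=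
  bddOfLinear (fun γ p => d1 γ p.1.2 i)
    (fun γ => (continuous_d1_coord γ i).comp (continuous_snd.comp continuous_subtype_val))
    (fun γ η p => by simp [d1_add]) (fun c γ p => by simp [d1_smul])
    (‖(cls 1 i : Sobolev 2 →L[ℝ] L2r)‖ + ‖(cls 2 i : Sobolev 2 →L[ℝ] L2r)‖) (by positivity)
    fun γ p => (abs_d1_le γ i _).trans <| by
      rw [add_mul]
      exact add_le_add (ContinuousLinearMap.le_opNorm _ _) (ContinuousLinearMap.le_opNorm _ _)

theorem exists_lift_near (x y : Circ) : ∃ a b : ℝ, (a : Circ) = x ∧ (b : Circ) = y ∧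
    |b - a| ≤ 1 / 2 := by
  induction x using QuotientAddGroup.induction_on with | H a => ?_
  obtain ⟨b, hb, rfl⟩ : ∃ b ∈ Ioc (a - 1 / 2) (a - 1 / 2 + 1), (b : Circ) = y := by
    have : y ∈ ((↑) : ℝ → Circ) '' Ioc (a - 1 / 2) (a - 1 / 2 + 1) := by
      rw [AddCircle.coe_image_Ioc_eq]; trivial
    exact this
  exact ⟨a, b, rfl, rfl, abs_le.mpr ⟨by linarith [hb.1], by linarith [hb.2]⟩⟩

theorem abs_chord_le (γ : Sobolev 2) (i : Fin 2) (x y : Circ) :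
    |chord γ x y i| ≤ (‖cls 1 i γ‖ + ‖cls 2 i γ‖) * dist x y := by
  obtain ⟨a, b, rfl, rfl, hab⟩ := exists_lift_near x y
  rw [dist_coe hab, chord, PiLp.sub_apply, val_sub]
  exact intervalIntegral.norm_integral_le_of_norm_le_const (f := fun t : ℝ => d1 γ (t : Circ) i)
    fun t _ => abs_d1_le γ i t

/-- The chord divided by the distance. -/
def chordD (i : Fin 2) : Sobolev 2 →L[ℝ] Bdd :=
  bddOfLinear (fun γ p => chord γ p.1.1 p.1.2 i / dist p.1.1 p.1.2)
    (fun γ => by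
      refine Continuous.div ?_ ?_ fun p => dist_ne_zero.mpr p.2
      · have h := continuous_val_coord γ i
        exact (h.comp (continuous_snd.comp continuous_subtype_val)).sub
          (h.comp (continuous_fst.comp continuous_subtype_val))
      · fun_prop)
    (fun γ η p => by simp only [chord, val_add, Pi.add_apply, PiLp.sub_apply, PiLp.add_apply]; ring)
    (fun c γ p => by
      simp only [chord, val_smul, Pi.smul_apply, PiLp.sub_apply, PiLp.smul_apply, smul_eq_mul]; ring)
    (‖(cls 1 i : Sobolev 2 →L[ℝ] L2r)‖ + ‖(cls 2 i : Sobolev 2 →L[ℝ] L2r)‖) (by positivity)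
    fun γ p => by
      have hd : 0 < dist p.1.1 p.1.2 := dist_pos.mpr p.2
      rw [abs_div, abs_of_pos hd, div_le_iff₀ hd]
      refine (abs_chord_le γ i _ _).trans (mul_le_mul_of_nonneg_right ?_ hd.le)
      rw [add_mul]
      exact add_le_add (ContinuousLinearMap.le_opNorm _ _) (ContinuousLinearMap.le_opNorm _ _)

theorem tanX_apply (i : Fin 2) (γ : Sobolev 2) (p : OffDiag) : tanX i γ p = d1 γ p.1.1 i := rfl

theorem tanY_apply (i : Fin 2) (γ : Sobolev 2) (p : OffDiag) : tanY i γ p = d1 γ p.1.2 i := rfl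

theorem chordD_apply (i : Fin 2) (γ : Sobolev 2) (p : OffDiag) :
    chordD i γ p = chord γ p.1.1 p.1.2 i / dist p.1.1 p.1.2 := rfl

theorem norm_plane (v : Plane) : ‖v‖ = √(v 0 ^ 2 + v 1 ^ 2) := by
  rw [EuclideanSpace.norm_eq]
  simp

instance : Nonempty OffDiag := by
  refine ⟨⟨(((0 : ℝ) : Circ), ((1 / 2 : ℝ) : Circ)), fun h => ?_⟩⟩
  have h1 := dist_coe (a := 0) (b := 1 / 2) (by norm_num)
  simp only at h
  rw [h, dist_self] at h1
  norm_num at h1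

theorem chordArc_le (γ : Sobolev 2) {x y : Circ} (h : x ≠ y) :
    chordArc γ * dist x y ≤ ‖chord γ x y‖ := by
  have hd : 0 < dist x y := dist_pos.mpr h
  have hb : BddBelow (Set.range fun p : {p : Circ × Circ // p.1 ≠ p.2} =>
      ‖val γ p.1.1 - val γ p.1.2‖ / dist p.1.1 p.1.2) :=
    ⟨0, by rintro _ ⟨p, rfl⟩; positivity⟩
  have := ciInf_le hb ⟨(x, y), h⟩
  rw [le_div_iff₀ hd, norm_sub_rev] at this
  exact this

theorem chord_sub (γ η : Sobolev 2) (x y : Circ) : chord (γ - η) x y = chord γ x y - chord η x y := by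
  have : γ - η = γ + (-1 : ℝ) • η := by rw [neg_one_smul, sub_eq_add_neg]
  rw [this]
  simp only [chord, val_add, Pi.add_apply]
  rw [val_smul]
  simp only [Pi.smul_apply, neg_one_smul]
  abel

theorem norm_chord_le (γ : Sobolev 2) {x y : Circ} (h : x ≠ y) :
    ‖chord γ x y‖ ≤ (‖chordD 0‖ + ‖chordD 1‖) * ‖γ‖ * dist x y := by
  have hd : 0 < dist x y := dist_pos.mpr h
  have hi : ∀ i, |chord γ x y i| ≤ ‖chordD i‖ * ‖γ‖ * dist x y := fun i => by
    have h1 := ((chordD i γ).norm_coe_le_norm ⟨(x, y), h⟩).trans ((chordD i).le_opNorm γ)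
    rw [chordD_apply, Real.norm_eq_abs, abs_div, abs_of_pos hd, div_le_iff₀ hd] at h1
    exact h1
  have h0 : ‖chord γ x y‖ ≤ |chord γ x y 0| + |chord γ x y 1| := by
    rw [norm_plane]
    refine Real.sqrt_le_iff.mpr ⟨by positivity, ?_⟩
    nlinarith [abs_nonneg (chord γ x y 0), abs_nonneg (chord γ x y 1),
      sq_abs (chord γ x y 0), sq_abs (chord γ x y 1),
      mul_nonneg (abs_nonneg (chord γ x y 0)) (abs_nonneg (chord γ x y 1))]
  linarith [hi 0, hi 1]

theorem isOpen_V : IsOpen V := by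
  rw [Metric.isOpen_iff]
  intro γ hγ
  have hγ' : 0 < chordArc γ := hγ
  -- The radius keeps the chord of γ - η below half of `chordArc γ` times the distance, so η retains
  -- half of the chord-arc constant. The 1 only makes M positive.
  set M := ‖chordD 0‖ + ‖chordD 1‖ + 1 with hM
  have hMpos : 0 < M := by positivity
  refine ⟨chordArc γ / (2 * M), by positivity, fun η hη => ?_⟩
  have hη' : ‖γ - η‖ < chordArc γ / (2 * M) := by
    rw [← dist_eq_norm, dist_comm]; exact hη
  rw [lt_div_iff₀ (by positivity)] at hη'
  refine lt_of_lt_of_le (half_pos hγ') (le_ciInf fun p => ?_)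
  have hd : 0 < dist p.1.1 p.1.2 := dist_pos.mpr p.2
  rw [le_div_iff₀ hd]
  have h1 := chordArc_le γ p.2
  have h2 := norm_chord_le (γ - η) p.2
  rw [chord_sub] at h2
  have h3 := norm_sub_norm_le (chord γ p.1.1 p.1.2) (chord η p.1.1 p.1.2)
  have h4 : ‖val η p.1.1 - val η p.1.2‖ = ‖chord η p.1.1 p.1.2‖ := norm_sub_rev _ _
  rw [h4]
  have h5 : (‖chordD 0‖ + ‖chordD 1‖) * ‖γ - η‖ ≤ chordArc γ / 2 := by
    nlinarith [norm_nonneg (γ - η)]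
  nlinarith [mul_le_mul_of_nonneg_right h5 hd.le]

theorem chordD_lower (γ : Sobolev 2) (hγ : γ ∈ V) (p : OffDiag) :
    chordArc γ ^ 2 ≤ chordD 0 γ p ^ 2 + chordD 1 γ p ^ 2 := by
  have hγ' : 0 < chordArc γ := hγ
  have hd : 0 < dist p.1.1 p.1.2 := dist_pos.mpr p.2
  have h := chordArc_le γ p.2
  rw [norm_plane] at h
  rw [chordD_apply, chordD_apply, div_pow, div_pow, ← add_div, le_div_iff₀ (by positivity), ← mul_pow]
  exact (Real.le_sqrt (by positivity) (by positivity)).mp h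

theorem hasDerivAt_val (γ : Sobolev 2) (i : Fin 2) (s : ℝ) :
    HasDerivAt (fun t : ℝ => val γ (t : Circ) i) (d1 γ (s : Circ) i) s := by
  have hcont : Continuous fun t : ℝ => d1 γ (t : Circ) i :=
    (continuous_d1_coord γ i).comp (AddCircle.continuous_mk' 1)
  have h := (hcont.integral_hasStrictDerivAt 0 s).hasDerivAt.const_add (val γ ((0 : ℝ) : Circ) i)
  refine h.congr_of_eventuallyEq (Eventually.of_forall fun t => ?_)
  simp only [← val_sub]
  ring

/-- The chord-arc inequality, divided by the squared distance, passes to the limit of difference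
quotients. -/
theorem d1_lower (γ : Sobolev 2) (hγ : γ ∈ V) (x : Circ) :
    chordArc γ ^ 2 ≤ d1 γ x 0 ^ 2 + d1 γ x 1 ^ 2 := by
  have hγ' : 0 < chordArc γ := hγ
  induction x using QuotientAddGroup.induction_on with | H s => ?_
  have h0 := (hasDerivAt_val γ 0 s).tendsto_slope
  have h1 := (hasDerivAt_val γ 1 s).tendsto_slope
  refine ge_of_tendsto ((h0.pow 2).add (h1.pow 2)) ?_
  have hnear : ∀ᶠ t in 𝓝[≠] s, |t - s| ≤ 1 / 2 :=
    nhdsWithin_le_nhds (by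
      filter_upwards [Metric.closedBall_mem_nhds s (by norm_num : (0 : ℝ) < 1 / 2)] with t ht
      rwa [Metric.mem_closedBall, Real.dist_eq] at ht)
  filter_upwards [hnear, self_mem_nhdsWithin] with t ht hne
  have hts : 0 < |t - s| := abs_pos.mpr (sub_ne_zero.mpr hne)
  have hdist := dist_coe ht
  have hne' : (s : Circ) ≠ (t : Circ) := by
    rw [← dist_pos, hdist]; exact hts
  have h := chordArc_le γ hne'
  rw [norm_plane, hdist] at h
  have h2 := (Real.le_sqrt (by positivity) (by positivity)).mp h
  rw [mul_pow, sq_abs] at h2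
  simp only [slope_def_field]
  rw [div_pow, div_pow, ← add_div, le_div_iff₀ (by rw [← sq_abs]; positivity)]
  exact h2

/-! ### Maps into `L²` represented by densities on the torus -/

/-- `F` is smooth on `V`, and `F γ` is the integral in `y` of the density `H γ (x, y)`, in the sense
of distributions. -/
structure IsSmoothDensity (F : Sobolev 2 → L2r) (H : Sobolev 2 → Circ × Circ → ℝ) : Prop where
  contDiffOn : ContDiffOn ℝ ∞ F V
  integrable : ∀ γ ∈ V, ∀ φ : Circ → ℝ, Continuous φ → Integrable fun p => φ p.1 * H γ p
  integral_eq : ∀ γ ∈ V, ∀ φ : Circ → ℝ, Continuous φ →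
    ∫ x, φ x * F γ x = ∫ p, φ p.1 * H γ p

theorem integrable_mul_L2r {φ : Circ → ℝ} (hφ : Continuous φ) (u : L2r) :
    Integrable fun x => φ x * u x := by
  obtain ⟨C, hC⟩ := (isCompact_range hφ).isBounded.exists_norm_le
  exact ((Lp.memLp u).integrable one_le_two).bdd_mul hφ.aestronglyMeasurable
    (Eventually.of_forall fun x => hC _ ⟨x, rfl⟩)

namespace IsSmoothDensity

variable {F F' : Sobolev 2 → L2r} {H H' : Sobolev 2 → Circ × Circ → ℝ}

theorem add (h : IsSmoothDensity F H) (h' : IsSmoothDensity F' H') :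
    IsSmoothDensity (fun γ => F γ + F' γ) (fun γ p => H γ p + H' γ p) where
  contDiffOn := h.contDiffOn.add h'.contDiffOn
  integrable γ hγ φ hφ := by
    simp_rw [mul_add]
    exact (h.integrable γ hγ φ hφ).add (h'.integrable γ hγ φ hφ)
  integral_eq γ hγ φ hφ := by
    simp_rw [mul_add]
    rw [integral_add (h.integrable γ hγ φ hφ) (h'.integrable γ hγ φ hφ),
      ← h.integral_eq γ hγ φ hφ, ← h'.integral_eq γ hγ φ hφ,
      ← integral_add (integrable_mul_L2r hφ _) (integrable_mul_L2r hφ _)]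
    refine integral_congr_ae ?_
    filter_upwards [Lp.coeFn_add (F γ) (F' γ)] with x hx
    rw [hx, Pi.add_apply, mul_add]

theorem sum {ι : Type*} [Fintype ι] {F : ι → Sobolev 2 → L2r}
    {H : ι → Sobolev 2 → Circ × Circ → ℝ} (h : ∀ i, IsSmoothDensity (F i) (H i)) :
    IsSmoothDensity (fun γ => ∑ i, F i γ) (fun γ p => ∑ i, H i γ p) := by
  classical
  have key : ∀ s : Finset ι,
      IsSmoothDensity (fun γ => ∑ i ∈ s, F i γ) (fun γ p => ∑ i ∈ s, H i γ p) := by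
    intro s
    induction s using Finset.induction_on with
    | empty =>
      simp only [Finset.sum_empty]
      refine ⟨contDiffOn_const, fun γ _ φ _ => by simp, fun γ _ φ _ => ?_⟩
      simp only [mul_zero, integral_zero]
      refine integral_eq_zero_of_ae ?_
      filter_upwards [Lp.coeFn_zero ℝ 2 (volume : Measure Circ)] with x hx
      rw [hx]; simp
    | insert i s hi ih =>
      simp only [Finset.sum_insert hi]
      exact (h i).add ih
  exact key Finset.univ

theorem const_smul (h : IsSmoothDensity F H) (c : ℝ) :
    IsSmoothDensity (fun γ => c • F γ) (fun γ p => c * H γ p) where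
  contDiffOn := h.contDiffOn.const_smul c
  integrable γ hγ φ hφ := by
    simp_rw [mul_left_comm]
    exact (h.integrable γ hγ φ hφ).const_mul c
  integral_eq γ hγ φ hφ := by
    simp_rw [mul_left_comm]
    rw [integral_const_mul, ← h.integral_eq γ hγ φ hφ, ← integral_const_mul]
    refine integral_congr_ae ?_
    filter_upwards [Lp.coeFn_smul c (F γ)] with x hx
    rw [hx, Pi.smul_apply, smul_eq_mul]; ring

/-- `pairing` is composed of continuous linear and bilinear maps, which gives smoothness; the
density is read off by testing the adjoint against φ. The hypothesis `hH` is almost everywhere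
because `w` and, for `sndK`, the kernel are L² classes. -/
theorem of_pairing {E : Type*} [NormedAddCommGroup E] [NormedSpace ℝ E] (B : KernelFamily E)
    {a : Sobolev 2 → Bdd} {e : Sobolev 2 → E} {w : Sobolev 2 → L2p} (ha : ContDiffOn ℝ ∞ a V)
    (he : ContDiffOn ℝ ∞ e V) (hw : ContDiffOn ℝ ∞ w V)
    (hH : ∀ γ, H γ =ᵐ[volume] fun p => extend (a γ) p * (B.toFun (e γ) p * w γ p)) :
    IsSmoothDensity (fun γ => pairing B (a γ) (e γ) (w γ)) H := by
  have key : ∀ γ, ∀ φ : Circ → ℝ, Continuous φ → Integrable (fun p => φ p.1 * H γ p) ∧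
      ∫ x, φ x * pairing B (a γ) (e γ) (w γ) x = ∫ p, φ p.1 * H γ p := by
    intro γ φ hφ
    have hφm : MemLp φ 2 := hφ.memLp_of_hasCompactSupport (HasCompactSupport.of_compactSpace _)
    obtain ⟨h1, h2⟩ := inner_pairing B (a γ) (e γ) (w γ) (hφm.toLp φ)
    have hcongr : (fun p => B.toFun (e γ) p * hφm.toLp φ p.1 * (extend (a γ) p * w γ p))
        =ᵐ[volume] fun p => φ p.1 * H γ p := by
      filter_upwards [hH γ, KernelFamily.ae_fst hφm.coeFn_toLp] with p hp hp'
      rw [hp, hp']; ring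
    refine ⟨h1.congr hcongr, ?_⟩
    rw [← integral_congr_ae hcongr, ← h2, L2.inner_def]
    refine integral_congr_ae ?_
    filter_upwards [hφm.coeFn_toLp] with x hx
    rw [hx, RCLike.inner_apply', RCLike.conj_to_real]
  refine ⟨?_, fun γ _ φ hφ => (key γ φ hφ).1, fun γ _ φ hφ => (key γ φ hφ).2⟩
  unfold pairing
  exact (adjointL.contDiff.comp_contDiffOn (B.lift.contDiff.comp_contDiffOn he)).clm_apply
    ((mulBdd.contDiff.comp_contDiffOn ha).clm_apply hw)

end IsSmoothDensity

/-! ### The forcing and its derivative as finite sums of pairings. -/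

/-- The constant function `1` in `L²`. -/
def oneL : L2r := (memLp_const (1 : ℝ)).toLp fun _ => (1 : ℝ)

theorem oneL_ae : oneL =ᵐ[volume] fun _ => (1 : ℝ) := (memLp_const (1 : ℝ)).coeFn_toLp

theorem contDiffOn_lift {E : Type*} [NormedAddCommGroup E] [NormedSpace ℝ E] (B : KernelFamily E)
    {e : Sobolev 2 → E} {u : Sobolev 2 → L2r} (he : ContDiffOn ℝ ∞ e V) (hu : ContDiffOn ℝ ∞ u V) :
    ContDiffOn ℝ ∞ (fun γ => B.lift (e γ) (u γ)) V :=
  (B.lift.contDiff.comp_contDiffOn he).clm_apply hu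

/-- Rotation by the matrix with rows `(0, 1)` and `(-1, 0)`. -/
def rot : Fin 2 → Fin 2 → ℝ := ![![0, 1], ![-1, 0] ]

/-- The rotated tangent at the first point. -/
def nX (i : Fin 2) (γ : Sobolev 2) : Bdd := ∑ k, rot i k • tanX k γ

/-- The rotated tangent at the second point. -/
def nY (i : Fin 2) (γ : Sobolev 2) : Bdd := ∑ k, rot i k • tanY k γ

/-- The inverse speed at the first point. -/
def rX (γ : Sobolev 2) : Bdd := invNorm (tanX 0 γ) (tanX 1 γ)

/-- The inverse speed at the second point. -/
def rY (γ : Sobolev 2) : Bdd := invNorm (tanY 0 γ) (tanY 1 γ)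

/-- The distance divided by the length of the chord. -/
def rD (γ : Sobolev 2) : Bdd := invNorm (chordD 0 γ) (chordD 1 γ)

/-- The common factor of all coefficients. -/
def common (l : Fin 2) (γ : Sobolev 2) : Bdd :=
  nY l γ * rY γ ^ 3 * rD γ ^ 3

/-- The chord divided by the distance, projected on the rotated tangent at the second point. -/
def nYD (γ : Sobolev 2) : Bdd := ∑ k, nY k γ * chordD k γ

/-- The chord divided by the distance, projected on the tangent at the first point. -/
def tXD (γ : Sobolev 2) : Bdd := ∑ k, tanX k γ * chordD k γ

/-- The coefficients of `forceH`. -/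
def coefF (j l i : Fin 2) (γ : Sobolev 2) : Bdd :=
  common l γ * rX γ ^ 2 * nX j γ * nX i γ * nYD γ

/-- The coefficients, in `dforceH`, of the products of `beta` with second derivatives at `x`. -/
def coefA (j l m i : Fin 2) (γ : Sobolev 2) : Bdd :=
  common l γ * nX i γ * nYD γ * (rot j m • rX γ ^ 2 - (2 : ℝ) • (rX γ ^ 4 * tanX m γ * nX j γ))

/-- The coefficients, in `dforceH`, of the products of the transpose of `beta` with second
derivatives at `x`. -/
def coefAT (j l m i : Fin 2) (γ : Sobolev 2) : Bdd :=
  -(common l γ * rX γ ^ 2 * nX j γ * (∑ k, rot k m • chordD k γ) * nY i γ)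

/-- The coefficients, in `dforceH`, of the products of `beta` and `eps`. -/
def coefB (j l i k : Fin 2) (γ : Sobolev 2) : Bdd :=
  -(common l γ * rX γ ^ 2 * nX j γ * nX i γ * nY k γ)

/-- The coefficients, in `dforceH`, of the products of `beta` and its transpose. -/
def coefBT (j l i k : Fin 2) (γ : Sobolev 2) : Bdd :=
  -((3 : ℝ) • (common l γ * rX γ ^ 2 * nX j γ * nX i γ * nY k γ * tXD γ * rD γ ^ 2))

section Smooth

theorem contDiffOn_clm (L : Sobolev 2 →L[ℝ] Bdd) : ContDiffOn ℝ ∞ (fun γ => L γ) V :=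
  L.contDiff.contDiffOn

theorem contDiffOn_tanX (k : Fin 2) : ContDiffOn ℝ ∞ (fun γ => tanX k γ) V := contDiffOn_clm _
theorem contDiffOn_chordD (k : Fin 2) : ContDiffOn ℝ ∞ (fun γ => chordD k γ) V := contDiffOn_clm _

theorem contDiffOn_nX (i : Fin 2) : ContDiffOn ℝ ∞ (nX i) V :=
  ContDiffOn.sum fun k _ => (contDiffOn_clm (tanX k)).const_smul _

theorem contDiffOn_nY (i : Fin 2) : ContDiffOn ℝ ∞ (nY i) V :=
  ContDiffOn.sum fun k _ => (contDiffOn_clm (tanY k)).const_smul _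

theorem contDiffOn_rX : ContDiffOn ℝ ∞ rX V :=
  contDiffOn_invNorm (contDiffOn_clm _) (contDiffOn_clm _) fun γ hγ =>
    ⟨chordArc γ ^ 2, pow_pos hγ 2, fun p => d1_lower γ hγ p.1.1⟩

theorem contDiffOn_rY : ContDiffOn ℝ ∞ rY V :=
  contDiffOn_invNorm (contDiffOn_clm _) (contDiffOn_clm _) fun γ hγ =>
    ⟨chordArc γ ^ 2, pow_pos hγ 2, fun p => d1_lower γ hγ p.1.2⟩

theorem contDiffOn_rD : ContDiffOn ℝ ∞ rD V :=
  contDiffOn_invNorm (contDiffOn_clm _) (contDiffOn_clm _) fun γ hγ =>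
    ⟨chordArc γ ^ 2, pow_pos hγ 2, fun p => chordD_lower γ hγ p⟩

theorem contDiffOn_common (l : Fin 2) : ContDiffOn ℝ ∞ (common l) V :=
  ((contDiffOn_nY l).mul (contDiffOn_rY.pow 3)).mul (contDiffOn_rD.pow 3)

theorem contDiffOn_nYD : ContDiffOn ℝ ∞ nYD V :=
  ContDiffOn.sum fun k _ => (contDiffOn_nY k).mul (contDiffOn_chordD k)

theorem contDiffOn_tXD : ContDiffOn ℝ ∞ tXD V :=
  ContDiffOn.sum fun k _ => (contDiffOn_tanX k).mul (contDiffOn_chordD k)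

theorem contDiffOn_coefF (j l i : Fin 2) : ContDiffOn ℝ ∞ (coefF j l i) V :=
  ((((contDiffOn_common l).mul (contDiffOn_rX.pow 2)).mul (contDiffOn_nX j)).mul
    (contDiffOn_nX i)).mul contDiffOn_nYD

theorem contDiffOn_coefA (j l m i : Fin 2) : ContDiffOn ℝ ∞ (coefA j l m i) V :=
  (((contDiffOn_common l).mul (contDiffOn_nX i)).mul contDiffOn_nYD).mul
    (((contDiffOn_rX.pow 2).const_smul _).sub
      ((((contDiffOn_rX.pow 4).mul (contDiffOn_tanX m)).mul (contDiffOn_nX j)).const_smul _))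

theorem contDiffOn_coefAT (j l m i : Fin 2) : ContDiffOn ℝ ∞ (coefAT j l m i) V :=
  (((((contDiffOn_common l).mul (contDiffOn_rX.pow 2)).mul (contDiffOn_nX j)).mul
    (ContDiffOn.sum fun k _ => (contDiffOn_chordD k).const_smul _)).mul (contDiffOn_nY i)).neg

theorem contDiffOn_coefB (j l i k : Fin 2) : ContDiffOn ℝ ∞ (coefB j l i k) V :=
  (((((contDiffOn_common l).mul (contDiffOn_rX.pow 2)).mul (contDiffOn_nX j)).mul
    (contDiffOn_nX i)).mul (contDiffOn_nY k)).neg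

theorem contDiffOn_coefBT (j l i k : Fin 2) : ContDiffOn ℝ ∞ (coefBT j l i k) V :=
  (((((((contDiffOn_common l).mul (contDiffOn_rX.pow 2)).mul (contDiffOn_nX j)).mul
    (contDiffOn_nX i)).mul (contDiffOn_nY k)).mul contDiffOn_tXD).mul
      (contDiffOn_rD.pow 2)).const_smul _ |>.neg

end Smooth

/-- The `j`-th coordinate of the forcing, as an element of `L²`. -/
def forceL (j : Fin 2) (γ : Sobolev 2) : L2r := (1 / (2 * Real.pi)) • ∑ l, ∑ i,
  pairing sndK (coefF j l i γ) (cls 2 l γ) ((betaK i).lift γ oneL)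

/-- The density of `forceL`. -/
def forceH (j : Fin 2) (γ : Sobolev 2) (p : Circ × Circ) : ℝ := (1 / (2 * Real.pi)) * ∑ l, ∑ i,
  extend (coefF j l i γ) p * (cls 2 l γ p.2 * beta i γ p)

/-- The `j`-th coordinate of the derivative of the forcing, as an element of `L²`. -/
def dforceL (j : Fin 2) (γ : Sobolev 2) : L2r := (1 / (2 * Real.pi)) • ∑ l,
  ((∑ m, ∑ i, (pairing sndK (coefA j l m i γ) (cls 2 l γ) ((betaK i).lift γ (cls 2 m γ)) +
      pairing sndK (coefAT j l m i γ) (cls 2 l γ) ((betaTK i).lift γ (cls 2 m γ)))) +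
    ∑ i, ∑ k, (pairing (betaK i) (coefB j l i k γ) γ (swapL ((epsTK k).lift γ (cls 2 l γ))) +
      pairing (betaK i) (coefBT j l i k γ) γ (swapL ((betaK k).lift γ (cls 2 l γ)))))

/-- The density of `dforceL`. -/
def dforceH (j : Fin 2) (γ : Sobolev 2) (p : Circ × Circ) : ℝ := (1 / (2 * Real.pi)) * ∑ l,
  ((∑ m, ∑ i, (extend (coefA j l m i γ) p * (cls 2 l γ p.2 * (beta i γ p * cls 2 m γ p.1)) +
      extend (coefAT j l m i γ) p * (cls 2 l γ p.2 * (beta i γ p.swap * cls 2 m γ p.1)))) +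
    ∑ i, ∑ k, (extend (coefB j l i k γ) p * (beta i γ p * (eps k γ p * cls 2 l γ p.2)) +
      extend (coefBT j l i k γ) p * (beta i γ p * (beta k γ p.swap * cls 2 l γ p.2))))

theorem isSmoothDensity_forceL (j : Fin 2) : IsSmoothDensity (forceL j) (forceH j) := by
  refine IsSmoothDensity.const_smul (.sum fun l => .sum fun i => ?_) _
  -- Lifting against `oneL` views `beta i γ` itself as an element of L² of the torus.
  refine .of_pairing sndK (contDiffOn_coefF j l i) (cls 2 l).contDiff.contDiffOn
    (contDiffOn_lift _ contDiffOn_id contDiffOn_const) fun γ => ?_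
  filter_upwards [(betaK i).lift_ae γ oneL, KernelFamily.ae_fst oneL_ae] with p h1 h2
  rw [h1, h2, mul_one]
  rfl

/-- This places the L² function at the second point. For fixed y the transposed kernel is then
integrated in x, which is how `eps(x,y) γ''(y)` and `beta(y,x) γ''(y)` are seen to be square
integrable. -/
theorem swapL_lift_ae {E : Type*} [NormedAddCommGroup E] [NormedSpace ℝ E] (B : KernelFamily E)
    (e : E) (u : L2r) :
    swapL (B.lift e u) =ᵐ[volume] fun p => B.toFun e p.swap * u p.2 := by
  have h := Measure.measurePreserving_swap (μ := (volume : Measure Circ))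
    (ν := (volume : Measure Circ)) |>.quasiMeasurePreserving.ae (B.lift_ae e u)
  filter_upwards [swapL_ae (B.lift e u), h] with p h1 h2
  rw [h1, h2]
  rfl

/-- Each term has three unbounded factors. When γ''(x) occurs, it is joined to `beta` or its
transpose and γ''(y) goes with the test function. Otherwise γ''(y) is joined to `eps` or to the
transposed `beta`, and the remaining `beta` goes with the test function. -/
theorem isSmoothDensity_dforceL (j : Fin 2) : IsSmoothDensity (dforceL j) (dforceH j) := by
  have hc : ∀ l, ContDiffOn ℝ ∞ (fun γ => cls 2 l γ) V := fun l => (cls 2 l).contDiff.contDiffOn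
  have hs : ∀ {w : Sobolev 2 → L2p}, ContDiffOn ℝ ∞ w V → ContDiffOn ℝ ∞ (fun γ => swapL (w γ)) V :=
    fun hw => swapL.contDiff.comp_contDiffOn hw
  refine IsSmoothDensity.const_smul (.sum fun l => .add (.sum fun m => .sum fun i => .add ?_ ?_)
    (.sum fun i => .sum fun k => .add ?_ ?_)) _
  · refine .of_pairing sndK (contDiffOn_coefA j l m i) (hc l)
      (contDiffOn_lift _ contDiffOn_id (hc m)) fun γ => ?_
    filter_upwards [(betaK i).lift_ae γ (cls 2 m γ)] with p h1
    rw [h1]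
    rfl
  · refine .of_pairing sndK (contDiffOn_coefAT j l m i) (hc l)
      (contDiffOn_lift _ contDiffOn_id (hc m)) fun γ => ?_
    filter_upwards [(betaTK i).lift_ae γ (cls 2 m γ)] with p h1
    rw [h1]
    rfl
  · refine .of_pairing (betaK i) (contDiffOn_coefB j l i k) contDiffOn_id
      (hs (contDiffOn_lift _ contDiffOn_id (hc l))) fun γ => ?_
    filter_upwards [swapL_lift_ae (epsTK k) γ (cls 2 l γ)] with p h1
    rw [h1]
    rfl
  · refine .of_pairing (betaK i) (contDiffOn_coefBT j l i k) contDiffOn_id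
      (hs (contDiffOn_lift _ contDiffOn_id (hc l))) fun γ => ?_
    filter_upwards [swapL_lift_ae (betaK k) γ (cls 2 l γ)] with p h1
    rw [h1]
    rfl

/-! ### The symmetric kernel -/

/-- The product of the rotated tangent at `x` with `v`. -/
def tn (γ : Sobolev 2) (x : Circ) (v : Plane) : ℝ := d1 γ x 1 * v 0 - d1 γ x 0 * v 1

/-- The kernel `(n(x) · Δ) (n(y) · Δ) / |Δ|³` with unnormalised normals. -/
def kap (γ : Sobolev 2) (x y : Circ) : ℝ :=
  tn γ x (chord γ x y) * tn γ y (chord γ x y) * (‖chord γ x y‖⁻¹) ^ 3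

theorem chord_swap (γ : Sobolev 2) (x y : Circ) : chord γ y x = -chord γ x y := by
  simp [chord]

theorem kap_comm (γ : Sobolev 2) (x y : Circ) : kap γ y x = kap γ x y := by
  simp only [kap, chord_swap γ x y, norm_neg, tn, PiLp.neg_apply]
  ring

/-- Expansion of the nonnegative integral of (|f| - mean)², where the mean is that of |f|. -/
theorem sq_integral_abs_le {f : ℝ → ℝ} {a b : ℝ} (hab : a < b)
    (hf : IntervalIntegrable f volume a b)
    (hf2 : IntervalIntegrable (fun t => f t ^ 2) volume a b) :
    (∫ t in a..b, |f t|) ^ 2 ≤ (b - a) * ∫ t in a..b, f t ^ 2 := by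
  have hL : 0 < b - a := sub_pos.mpr hab
  set I := ∫ t in a..b, |f t| with hI
  have h0 : 0 ≤ ∫ t in a..b, (f t ^ 2 - (2 * (I / (b - a))) * |f t| + (I / (b - a)) ^ 2) := by
    refine intervalIntegral.integral_nonneg hab.le fun t _ => ?_
    nlinarith [sq_nonneg (|f t| - I / (b - a)), sq_abs (f t)]
  rw [intervalIntegral.integral_add (hf2.sub (hf.abs.const_mul _)) (by simp),
    intervalIntegral.integral_sub hf2 (hf.abs.const_mul _), intervalIntegral.integral_const_mul,
    intervalIntegral.integral_const, ← hI, smul_eq_mul] at h0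
  have h1 : (b - a) * (∫ t in a..b, f t ^ 2) - I ^ 2 =
      (b - a) * ((∫ t in a..b, f t ^ 2) - 2 * (I / (b - a)) * I + (b - a) * (I / (b - a)) ^ 2) := by
    field_simp
    ring
  nlinarith [mul_nonneg hL.le h0]

/-- The square of the norm of the second derivative. -/
def accel (γ : Sobolev 2) (x : Circ) : ℝ := cls 2 0 γ x ^ 2 + cls 2 1 γ x ^ 2

theorem integrable_cls_sq (γ : Sobolev 2) (i : Fin 2) :
    Integrable fun x => (cls 2 i γ : Circ → ℝ) x ^ 2 := (Lp.memLp _).integrable_sq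

theorem integrable_accel (γ : Sobolev 2) : Integrable (accel γ) :=
  (integrable_cls_sq γ 0).add (integrable_cls_sq γ 1)

theorem exists_d1_bound (γ : Sobolev 2) : ∃ M, 0 ≤ M ∧ ∀ x i, |d1 γ x i| ≤ M := by
  refine ⟨(‖cls 1 0 γ‖ + ‖cls 2 0 γ‖) + (‖cls 1 1 γ‖ + ‖cls 2 1 γ‖), by positivity, fun x i => ?_⟩
  refine (abs_d1_le γ i x).trans ?_
  fin_cases i
  · exact le_add_of_nonneg_right (by positivity)
  · exact le_add_of_nonneg_left (by positivity)

/-- The normal at c annihilates γ'(c), so the chord may be replaced by its Taylor remainder based at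
c. -/
theorem abs_tn_le (γ : Sobolev 2) {M : ℝ} (hM : ∀ x i, |d1 γ x i| ≤ M) {a b c : ℝ}
    (hab : a ≤ b) (hc : c ∈ Icc a b) :
    |tn γ (c : Circ) (chord γ (a : Circ) (b : Circ))| ≤ M * (b - a) *
      ((∫ t in a..b, |cls 2 0 γ (t : Circ)|) + ∫ t in a..b, |cls 2 1 γ (t : Circ)|) := by
  have h0 := abs_taylor_le γ 0 hab hc
  have h1 := abs_taylor_le γ 1 hab hc
  have e : tn γ (c : Circ) (chord γ (a : Circ) (b : Circ)) =
      d1 γ (c : Circ) 1 * (val γ (b : Circ) 0 - val γ (a : Circ) 0 - (b - a) * d1 γ (c : Circ) 0) -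
      d1 γ (c : Circ) 0 *
        (val γ (b : Circ) 1 - val γ (a : Circ) 1 - (b - a) * d1 γ (c : Circ) 1) := by
    simp only [tn, chord, PiLp.sub_apply]; ring
  have hM0 : 0 ≤ M := (abs_nonneg _).trans (hM 0 0)
  rw [e]
  refine (abs_sub _ _).trans ?_
  rw [abs_mul, abs_mul]
  have k0 := mul_le_mul (hM (c : Circ) 1) h0 (abs_nonneg _) hM0
  have k1 := mul_le_mul (hM (c : Circ) 0) h1 (abs_nonneg _) hM0
  linarith

/-- With L = b - a and I the integral of |γ''|, each factor n·Δ is O(L I) and |Δ|⁻³ is O(L⁻³). The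
kernel is thus O(I²/L), and Cauchy–Schwarz bounds I²/L by the integral of |γ''|². -/
theorem exists_kap_bound (γ : Sobolev 2) (hγ : γ ∈ V) : ∃ C, 0 ≤ C ∧ ∀ a b : ℝ, a < b →
    b - a ≤ 1 / 2 → |kap γ (a : Circ) (b : Circ)| ≤ C * ∫ t in a..b, accel γ (t : Circ) := by
  obtain ⟨M, hM0, hM⟩ := exists_d1_bound γ
  have hγ' : 0 < chordArc γ := hγ
  refine ⟨2 * M ^ 2 * (chordArc γ)⁻¹ ^ 3, by positivity, fun a b hab hb => ?_⟩
  have hL : 0 < b - a := sub_pos.mpr hab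
  have hdist : dist (a : Circ) (b : Circ) = b - a := by
    rw [dist_coe, abs_of_pos hL]; rwa [abs_of_pos hL]
  have hne : (a : Circ) ≠ (b : Circ) := by rw [← dist_pos, hdist]; exact hL
  have hR : ‖chord γ (a : Circ) (b : Circ)‖⁻¹ ≤ (chordArc γ)⁻¹ * (b - a)⁻¹ := by
    rw [← mul_inv]
    refine inv_anti₀ (by positivity) ?_
    rw [← hdist]; exact chordArc_le γ hne
  set I0 := ∫ t in a..b, |cls 2 0 γ (t : Circ)| with hI0
  set I1 := ∫ t in a..b, |cls 2 1 γ (t : Circ)| with hI1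
  have ha := abs_tn_le γ hM hab.le (c := a) ⟨le_rfl, hab.le⟩
  have hb' := abs_tn_le γ hM hab.le (c := b) ⟨hab.le, le_rfl⟩
  rw [← hI0, ← hI1] at ha hb'
  have c0 := sq_integral_abs_le hab (integrable_lift (integrable_cls 2 0 γ) a b)
    (integrable_lift (integrable_cls_sq γ 0) a b)
  have c1 := sq_integral_abs_le hab (integrable_lift (integrable_cls 2 1 γ) a b)
    (integrable_lift (integrable_cls_sq γ 1) a b)
  have hacc : ∫ t in a..b, accel γ (t : Circ) = (∫ t in a..b, cls 2 0 γ (t : Circ) ^ 2) +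
      ∫ t in a..b, cls 2 1 γ (t : Circ) ^ 2 :=
    intervalIntegral.integral_add (integrable_lift (integrable_cls_sq γ 0) a b)
      (integrable_lift (integrable_cls_sq γ 1) a b)
  -- The two coordinates are recombined by (I0 + I1)² ≤ 2(I0² + I1²), the source of the 2 in the
  -- constant.
  have hI : (I0 + I1) ^ 2 ≤ 2 * ((b - a) * ∫ t in a..b, accel γ (t : Circ)) := by
    rw [hacc]; nlinarith [sq_nonneg (I0 - I1)]
  rw [kap, abs_mul, abs_mul, abs_of_nonneg (by positivity : 0 ≤ (‖chord γ (a : Circ) (b : Circ)‖⁻¹) ^ 3)]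
  have hI0n : 0 ≤ I0 := intervalIntegral.integral_nonneg hab.le fun _ _ => abs_nonneg _
  have hI1n : 0 ≤ I1 := intervalIntegral.integral_nonneg hab.le fun _ _ => abs_nonneg _
  calc _ ≤ (M * (b - a) * (I0 + I1)) * (M * (b - a) * (I0 + I1)) *
        ((chordArc γ)⁻¹ * (b - a)⁻¹) ^ 3 := by gcongr
    _ = M ^ 2 * (chordArc γ)⁻¹ ^ 3 * (b - a)⁻¹ * (I0 + I1) ^ 2 := by field_simp
    _ ≤ M ^ 2 * (chordArc γ)⁻¹ ^ 3 * (b - a)⁻¹ *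
        (2 * ((b - a) * ∫ t in a..b, accel γ (t : Circ))) := by gcongr
    _ = _ := by field_simp

/-! ### Explicit formulas for the densities -/

/-- The factor of the density depending only on the second point. -/
def srcY (γ : Sobolev 2) (y : Circ) : ℝ :=
  ‖d1 γ y‖⁻¹ ^ 3 * (d1 γ y 1 * cls 2 0 γ y - d1 γ y 0 * cls 2 1 γ y)

/-- The rotated tangent. -/
def nrm (γ : Sobolev 2) (x : Circ) : Fin 2 → ℝ := ![d1 γ x 1, -d1 γ x 0]

/-- The derivative of the rotated tangent. -/
def dnrm (γ : Sobolev 2) (x : Circ) : Fin 2 → ℝ := ![cls 2 1 γ x, -cls 2 0 γ x]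

section Extend

variable (γ : Sobolev 2)

theorem nX_apply (j : Fin 2) (p : OffDiag) : nX j γ p = nrm γ p.1.1 j := by
  fin_cases j <;> simp [nX, rot, Fin.sum_univ_two, tanX_apply, nrm]

theorem nY_apply (j : Fin 2) (p : OffDiag) : nY j γ p = nrm γ p.1.2 j := by
  fin_cases j <;> simp [nY, rot, Fin.sum_univ_two, tanY_apply, nrm]

theorem rX_apply (hγ : γ ∈ V) (p : OffDiag) : rX γ p = ‖d1 γ p.1.1‖⁻¹ := by
  rw [rX, invNorm_apply (pow_pos hγ 2) fun p => d1_lower γ hγ p.1.1, norm_plane]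
  rfl

theorem rY_apply (hγ : γ ∈ V) (p : OffDiag) : rY γ p = ‖d1 γ p.1.2‖⁻¹ := by
  rw [rY, invNorm_apply (pow_pos hγ 2) fun p => d1_lower γ hγ p.1.2, norm_plane]
  rfl

theorem rD_apply (hγ : γ ∈ V) (p : OffDiag) :
    rD γ p = dist p.1.1 p.1.2 * ‖chord γ p.1.1 p.1.2‖⁻¹ := by
  have hd : 0 < dist p.1.1 p.1.2 := dist_pos.mpr p.2
  rw [rD, invNorm_apply (pow_pos hγ 2) fun p => chordD_lower γ hγ p, norm_plane, chordD_apply,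
    chordD_apply, div_pow, div_pow, ← add_div, Real.sqrt_div (by positivity), Real.sqrt_sq hd.le,
    inv_div, div_eq_mul_inv]

end Extend

theorem nYD_apply (γ : Sobolev 2) (p : OffDiag) :
    nYD γ p = tn γ p.1.2 (chord γ p.1.1 p.1.2) / dist p.1.1 p.1.2 := by
  simp only [nYD, Fin.sum_univ_two, BoundedContinuousFunction.coe_add, Pi.add_apply,
    BoundedContinuousFunction.coe_mul, Pi.mul_apply, nY_apply, chordD_apply, nrm, tn,
    Matrix.cons_val_zero, Matrix.cons_val_one]
  ring

theorem tXD_apply (γ : Sobolev 2) (p : OffDiag) :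
    tXD γ p = (chord γ p.1.1 p.1.2 0 * d1 γ p.1.1 0 + chord γ p.1.1 p.1.2 1 * d1 γ p.1.1 1) /
      dist p.1.1 p.1.2 := by
  simp only [tXD, Fin.sum_univ_two, BoundedContinuousFunction.coe_add, Pi.add_apply,
    BoundedContinuousFunction.coe_mul, Pi.mul_apply, tanX_apply, chordD_apply]
  ring

theorem common_apply (l : Fin 2) {γ : Sobolev 2} (hγ : γ ∈ V) (p : OffDiag) :
    common l γ p = nrm γ p.1.2 l * ‖d1 γ p.1.2‖⁻¹ ^ 3 *
      (dist p.1.1 p.1.2 * ‖chord γ p.1.1 p.1.2‖⁻¹) ^ 3 := by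
  simp only [common, BoundedContinuousFunction.coe_mul, Pi.mul_apply,
    BoundedContinuousFunction.coe_pow, Pi.pow_apply, nY_apply, rY_apply γ hγ, rD_apply γ hγ]

theorem sum_nrm_mul_beta (γ : Sobolev 2) (x y : Circ) :
    nrm γ x 0 * beta 0 γ (x, y) + nrm γ x 1 * beta 1 γ (x, y) =
      tn γ x (chord γ x y) / dist x y ^ 2 := by
  simp only [nrm, beta, tn, chord, PiLp.sub_apply, Matrix.cons_val_zero, Matrix.cons_val_one]
  ring

theorem sum_nrm_mul_beta_swap (γ : Sobolev 2) (x y : Circ) :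
    nrm γ y 0 * beta 0 γ (y, x) + nrm γ y 1 * beta 1 γ (y, x) =
      -(tn γ y (chord γ x y) / dist x y ^ 2) := by
  rw [sum_nrm_mul_beta, chord_swap γ x y, dist_comm]
  simp only [tn, PiLp.neg_apply]
  ring

theorem sum_nrm_mul_eps (γ : Sobolev 2) (x y : Circ) :
    nrm γ y 0 * eps 0 γ (x, y) + nrm γ y 1 * eps 1 γ (x, y) =
      (d1 γ y 1 * d1 γ x 0 - d1 γ y 0 * d1 γ x 1) / dist x y := by
  simp only [nrm, eps, Matrix.cons_val_zero, Matrix.cons_val_one]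
  ring

/-- The powers of the distance balance: d² from `beta` and d from `nYD` against d³ in `rD ^ 3`. -/
theorem forceH_eq (j : Fin 2) {γ : Sobolev 2} (hγ : γ ∈ V) {x y : Circ} (h : x ≠ y) :
    forceH j γ (x, y) = (1 / (2 * Real.pi)) *
      (srcY γ y * (‖d1 γ x‖⁻¹ ^ 2 * nrm γ x j * kap γ x y)) := by
  have hd : dist x y ≠ 0 := dist_ne_zero.mpr h
  have hext : ∀ l i, extend (coefF j l i γ) (x, y) =
      nrm γ y l * ‖d1 γ y‖⁻¹ ^ 3 * (dist x y * ‖chord γ x y‖⁻¹) ^ 3 * ‖d1 γ x‖⁻¹ ^ 2 *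
      nrm γ x j * nrm γ x i * (tn γ y (chord γ x y) / dist x y) := by
    intro l i
    rw [extend_of_ne _ h]
    simp only [coefF, BoundedContinuousFunction.coe_mul, Pi.mul_apply, common_apply l hγ,
      BoundedContinuousFunction.coe_pow, Pi.pow_apply, nX_apply, rX_apply γ hγ, nYD_apply]
  have hb := sum_nrm_mul_beta γ x y
  rw [eq_div_iff (pow_ne_zero 2 hd)] at hb
  have hs : srcY γ y = ‖d1 γ y‖⁻¹ ^ 3 * (nrm γ y 0 * cls 2 0 γ y + nrm γ y 1 * cls 2 1 γ y) := by
    simp only [srcY, nrm, Matrix.cons_val_zero, Matrix.cons_val_one]; ring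
  simp only [forceH, hext, Fin.sum_univ_two, kap, hs, ← hb]
  generalize tn γ y (chord γ x y) = N
  generalize ‖chord γ x y‖⁻¹ = R
  generalize dist x y = d at *
  field_simp

theorem dforceH_eq (j : Fin 2) {γ : Sobolev 2} (hγ : γ ∈ V) {x y : Circ} (h : x ≠ y) :
    dforceH j γ (x, y) = (1 / (2 * Real.pi)) * (srcY γ y *
      ((‖d1 γ x‖⁻¹ ^ 2 * dnrm γ x j - 2 * ‖d1 γ x‖⁻¹ ^ 4 *
          (d1 γ x 0 * cls 2 0 γ x + d1 γ x 1 * cls 2 1 γ x) * nrm γ x j) * kap γ x y +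
        ‖d1 γ x‖⁻¹ ^ 2 * nrm γ x j *
          (((cls 2 1 γ x * chord γ x y 0 - cls 2 0 γ x * chord γ x y 1) * tn γ y (chord γ x y) -
              tn γ x (chord γ x y) * (d1 γ y 1 * d1 γ x 0 - d1 γ y 0 * d1 γ x 1)) *
              ‖chord γ x y‖⁻¹ ^ 3 +
            3 * (tn γ x (chord γ x y) * tn γ y (chord γ x y)) *
              (chord γ x y 0 * d1 γ x 0 + chord γ x y 1 * d1 γ x 1) * ‖chord γ x y‖⁻¹ ^ 5))) := by
  have hd : dist x y ≠ 0 := dist_ne_zero.mpr h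
  have hA : ∀ l m i, extend (coefA j l m i γ) (x, y) =
      nrm γ y l * ‖d1 γ y‖⁻¹ ^ 3 * (dist x y * ‖chord γ x y‖⁻¹) ^ 3 *
      nrm γ x i * (tn γ y (chord γ x y) / dist x y) *
      (rot j m * ‖d1 γ x‖⁻¹ ^ 2 - 2 * (‖d1 γ x‖⁻¹ ^ 4 * d1 γ x m * nrm γ x j)) := by
    intro l m i
    rw [extend_of_ne _ h]
    simp only [coefA, BoundedContinuousFunction.coe_mul, Pi.mul_apply, common_apply l hγ,
      BoundedContinuousFunction.coe_pow, Pi.pow_apply, nX_apply, rX_apply γ hγ, nYD_apply,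
      BoundedContinuousFunction.coe_sub, Pi.sub_apply, BoundedContinuousFunction.coe_smul,
      smul_eq_mul, tanX_apply]
  have hAT : ∀ l m i, extend (coefAT j l m i γ) (x, y) =
      -(nrm γ y l * ‖d1 γ y‖⁻¹ ^ 3 * (dist x y * ‖chord γ x y‖⁻¹) ^ 3 *
      ‖d1 γ x‖⁻¹ ^ 2 * nrm γ x j *
      ((rot 0 m * chord γ x y 0 + rot 1 m * chord γ x y 1) / dist x y) * nrm γ y i) := by
    intro l m i
    rw [extend_of_ne _ h]
    simp only [coefAT, BoundedContinuousFunction.coe_mul, Pi.mul_apply, common_apply l hγ,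
      BoundedContinuousFunction.coe_pow, Pi.pow_apply, nX_apply, nY_apply, rX_apply γ hγ,
      BoundedContinuousFunction.coe_neg, Pi.neg_apply, BoundedContinuousFunction.coe_smul,
      smul_eq_mul, chordD_apply, Fin.sum_univ_two, BoundedContinuousFunction.coe_add, Pi.add_apply]
    ring
  have hB : ∀ l i k, extend (coefB j l i k γ) (x, y) =
      -(nrm γ y l * ‖d1 γ y‖⁻¹ ^ 3 * (dist x y * ‖chord γ x y‖⁻¹) ^ 3 *
      ‖d1 γ x‖⁻¹ ^ 2 * nrm γ x j * nrm γ x i * nrm γ y k) := by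
    intro l i k
    rw [extend_of_ne _ h]
    simp only [coefB, BoundedContinuousFunction.coe_mul, Pi.mul_apply, common_apply l hγ,
      BoundedContinuousFunction.coe_pow, Pi.pow_apply, nX_apply, nY_apply, rX_apply γ hγ,
      BoundedContinuousFunction.coe_neg, Pi.neg_apply]
  have hBT : ∀ l i k, extend (coefBT j l i k γ) (x, y) =
      -(3 * (nrm γ y l * ‖d1 γ y‖⁻¹ ^ 3 * (dist x y * ‖chord γ x y‖⁻¹) ^ 3 *
      ‖d1 γ x‖⁻¹ ^ 2 * nrm γ x j * nrm γ x i * nrm γ y k *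
      ((chord γ x y 0 * d1 γ x 0 + chord γ x y 1 * d1 γ x 1) / dist x y) *
      (dist x y * ‖chord γ x y‖⁻¹) ^ 2)) := by
    intro l i k
    rw [extend_of_ne _ h]
    simp only [coefBT, BoundedContinuousFunction.coe_mul, Pi.mul_apply, common_apply l hγ,
      BoundedContinuousFunction.coe_pow, Pi.pow_apply, nX_apply, nY_apply, rX_apply γ hγ,
      BoundedContinuousFunction.coe_neg, Pi.neg_apply, BoundedContinuousFunction.coe_smul,
      smul_eq_mul, tXD_apply, rD_apply γ hγ]
  have hs : srcY γ y = ‖d1 γ y‖⁻¹ ^ 3 * (nrm γ y 0 * cls 2 0 γ y + nrm γ y 1 * cls 2 1 γ y) := by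
    simp only [srcY, nrm, Matrix.cons_val_zero, Matrix.cons_val_one]; ring
  have hdn : dnrm γ x j = rot j 0 * cls 2 0 γ x + rot j 1 * cls 2 1 γ x := by
    fin_cases j <;> simp [dnrm, rot]
  -- The index sums are first factored into scalar products with the normals, to which the three
  -- summation identities for `beta`, its transpose and `eps` apply. The `eps` term arises because
  -- n(y)·γ'(x) = n(y)·(γ'(x) - γ'(y)).
  have hfac : dforceH j γ (x, y) = (1 / (2 * Real.pi)) *
      (‖d1 γ y‖⁻¹ ^ 3 * (nrm γ y 0 * cls 2 0 γ y + nrm γ y 1 * cls 2 1 γ y) *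
        (dist x y * ‖chord γ x y‖⁻¹) ^ 3 *
      ((‖d1 γ x‖⁻¹ ^ 2 * (rot j 0 * cls 2 0 γ x + rot j 1 * cls 2 1 γ x) - 2 * ‖d1 γ x‖⁻¹ ^ 4 *
          (d1 γ x 0 * cls 2 0 γ x + d1 γ x 1 * cls 2 1 γ x) * nrm γ x j) *
          ((nrm γ x 0 * beta 0 γ (x, y) + nrm γ x 1 * beta 1 γ (x, y)) *
            (tn γ y (chord γ x y) / dist x y)) -
        ‖d1 γ x‖⁻¹ ^ 2 * nrm γ x j *
          (((rot 0 0 * chord γ x y 0 + rot 1 0 * chord γ x y 1) / dist x y * cls 2 0 γ x +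
            (rot 0 1 * chord γ x y 0 + rot 1 1 * chord γ x y 1) / dist x y * cls 2 1 γ x) *
            (nrm γ y 0 * beta 0 γ (y, x) + nrm γ y 1 * beta 1 γ (y, x)) +
          (nrm γ x 0 * beta 0 γ (x, y) + nrm γ x 1 * beta 1 γ (x, y)) *
            (nrm γ y 0 * eps 0 γ (x, y) + nrm γ y 1 * eps 1 γ (x, y)) +
          3 * ((nrm γ x 0 * beta 0 γ (x, y) + nrm γ x 1 * beta 1 γ (x, y)) *
            (nrm γ y 0 * beta 0 γ (y, x) + nrm γ y 1 * beta 1 γ (y, x)) *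
            ((chord γ x y 0 * d1 γ x 0 + chord γ x y 1 * d1 γ x 1) / dist x y)) *
            (dist x y * ‖chord γ x y‖⁻¹) ^ 2))) := by
    simp only [dforceH, hA, hAT, hB, hBT, Fin.sum_univ_two, Prod.swap_prod_mk]
    ring
  rw [hfac, sum_nrm_mul_beta, sum_nrm_mul_beta_swap, sum_nrm_mul_eps, hs, hdn, kap]
  simp only [rot, Matrix.cons_val_zero, Matrix.cons_val_one]
  generalize tn γ y (chord γ x y) = N
  generalize ‖chord γ x y‖⁻¹ = R
  generalize dist x y = d at *
  field_simp
  ring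

/-! ### The derivative of the kernel in the first variable -/

/-- The kernel `|γ'(x)|⁻² n(x)_j (n(x) · Δ) (n(y) · Δ) / |Δ|³`. -/
def ker (j : Fin 2) (γ : Sobolev 2) (y x : Circ) : ℝ := ‖d1 γ x‖⁻¹ ^ 2 * nrm γ x j * kap γ x y

/-- The derivative of `ker` in `x`. -/
def dker (j : Fin 2) (γ : Sobolev 2) (y x : Circ) : ℝ :=
  (‖d1 γ x‖⁻¹ ^ 2 * dnrm γ x j - 2 * ‖d1 γ x‖⁻¹ ^ 4 *
      (d1 γ x 0 * cls 2 0 γ x + d1 γ x 1 * cls 2 1 γ x) * nrm γ x j) * kap γ x y +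
    ‖d1 γ x‖⁻¹ ^ 2 * nrm γ x j *
      (((cls 2 1 γ x * chord γ x y 0 - cls 2 0 γ x * chord γ x y 1) * tn γ y (chord γ x y) -
          tn γ x (chord γ x y) * (d1 γ y 1 * d1 γ x 0 - d1 γ y 0 * d1 γ x 1)) *
          ‖chord γ x y‖⁻¹ ^ 3 +
        3 * (tn γ x (chord γ x y) * tn γ y (chord γ x y)) *
          (chord γ x y 0 * d1 γ x 0 + chord γ x y 1 * d1 γ x 1) * ‖chord γ x y‖⁻¹ ^ 5)

theorem hasACDeriv_d1 (γ : Sobolev 2) (i : Fin 2) (a b : ℝ) :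
    HasACDeriv (fun s : ℝ => d1 γ (s : Circ) i) (fun s : ℝ => cls 2 i γ (s : Circ)) a b :=
  .of_integral (integrable_lift (integrable_cls 2 i γ) a b) fun x => by rw [← d1_sub]; ring

theorem hasACDeriv_chord (γ : Sobolev 2) (y : Circ) (i : Fin 2) (a b : ℝ) :
    HasACDeriv (fun s : ℝ => chord γ (s : Circ) y i) (fun s : ℝ => -d1 γ (s : Circ) i) a b := by
  have hcont : Continuous fun t : ℝ => d1 γ (t : Circ) i :=
    (continuous_d1_coord γ i).comp (AddCircle.continuous_mk' 1)
  refine .of_integral (hcont.neg.intervalIntegrable _ _) fun x => ?_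
  rw [intervalIntegral.integral_neg, ← val_sub]
  simp only [chord, PiLp.sub_apply]
  ring

theorem rpow_neg_half (v : Plane) (n : ℕ) :
    (v 0 ^ 2 + v 1 ^ 2) ^ (-(n / 2) : ℝ) = ‖v‖⁻¹ ^ n := by
  have h0 : 0 ≤ v 0 ^ 2 + v 1 ^ 2 := by positivity
  rw [norm_plane, Real.sqrt_eq_rpow, ← Real.rpow_neg h0, ← Real.rpow_natCast _ n, ← Real.rpow_mul h0]
  congr 1
  ring

theorem sq_add_sq_pos {v : Plane} (hv : v ≠ 0) : 0 < v 0 ^ 2 + v 1 ^ 2 := by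
  have := norm_pos_iff.mpr hv
  rw [norm_plane] at this
  exact Real.sqrt_pos.mp this

theorem chord_ne_zero {γ : Sobolev 2} (hγ : γ ∈ V) {x y : Circ} (h : x ≠ y) : chord γ x y ≠ 0 := by
  have h1 := chordArc_le γ h
  have h2 : 0 < chordArc γ * dist x y := mul_pos hγ (dist_pos.mpr h)
  exact norm_pos_iff.mp (h2.trans_le h1)

theorem hasACDeriv_norm_inv {u : ℝ → Plane} {w : ℝ → Fin 2 → ℝ} {a b : ℝ}
    (h : ∀ i, HasACDeriv (fun s => u s i) (fun s => w s i) a b)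
    (hu : ∀ s ∈ uIcc a b, u s ≠ 0) (n : ℕ) :
    HasACDeriv (fun s => ‖u s‖⁻¹ ^ n)
      (fun s => -n * (u s 0 * w s 0 + u s 1 * w s 1) * ‖u s‖⁻¹ ^ (n + 2)) a b := by
  have hq := ((h 0).mul (h 0)).add ((h 1).mul (h 1))
  have hp := hq.rpow_const (p := -(n / 2))
    (fun s hs => by have := sq_add_sq_pos (hu s hs); simpa [sq] using this)
  have e1 : (fun s => ‖u s‖⁻¹ ^ n) = fun s => (u s 0 * u s 0 + u s 1 * u s 1) ^ (-(n / 2) : ℝ) := by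
    funext s
    rw [← rpow_neg_half, sq, sq]
  rw [e1]
  refine hp.congr_deriv fun s _ => ?_
  have e2 : (u s 0 * u s 0 + u s 1 * u s 1) ^ (-(n / 2) - 1 : ℝ) = ‖u s‖⁻¹ ^ (n + 2) := by
    rw [← rpow_neg_half, sq, sq]
    congr 1
    push_cast
    ring
  rw [e2]
  ring

theorem hasACDeriv_nrm (γ : Sobolev 2) (j : Fin 2) (a b : ℝ) :
    HasACDeriv (fun s : ℝ => nrm γ (s : Circ) j) (fun s : ℝ => dnrm γ (s : Circ) j) a b := by
  fin_cases j
  · exact hasACDeriv_d1 γ 1 a b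
  · exact (hasACDeriv_d1 γ 0 a b).neg

theorem d1_ne_zero {γ : Sobolev 2} (hγ : γ ∈ V) (x : Circ) : d1 γ x ≠ 0 := by
  intro h
  have h1 := d1_lower γ hγ x
  have h2 : 0 < chordArc γ ^ 2 := pow_pos hγ 2
  rw [h] at h1
  simp only [PiLp.zero_apply] at h1
  norm_num at h1
  rw [h1] at h2
  norm_num at h2

/-- Product rule. In the derivative of n(x)·Δ the contribution of Δ is -n(x)·γ'(x) = 0, so only the
derivative of n survives there. -/
theorem hasACDeriv_ker (j : Fin 2) {γ : Sobolev 2} (hγ : γ ∈ V) (y : Circ) {a b : ℝ}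
    (h : ∀ s ∈ uIcc a b, (s : Circ) ≠ y) :
    HasACDeriv (fun s : ℝ => ker j γ y (s : Circ)) (fun s : ℝ => dker j γ y (s : Circ)) a b := by
  have hP := fun i => hasACDeriv_d1 γ i a b
  have hC := fun i => hasACDeriv_chord γ y i a b
  have hr := hasACDeriv_norm_inv (u := fun s : ℝ => d1 γ (s : Circ))
    (w := fun (s : ℝ) i => cls 2 i γ (s : Circ)) hP (fun s _ => d1_ne_zero hγ _) 2
  have hR := hasACDeriv_norm_inv (u := fun s : ℝ => chord γ (s : Circ) y)
    (w := fun (s : ℝ) i => -d1 γ (s : Circ) i) hC (fun s hs => chord_ne_zero hγ (h s hs)) 3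
  have hX := ((hP 1).mul (hC 0)).sub ((hP 0).mul (hC 1))
  have hY := ((HasACDeriv.const (d1 γ y 1)).mul (hC 0)).sub
    ((HasACDeriv.const (d1 γ y 0)).mul (hC 1))
  refine ((hr.mul (hasACDeriv_nrm γ j a b)).mul ((hX.mul hY).mul hR)).congr_deriv fun s _ => ?_
  simp only [dker, kap, tn]
  push_cast
  ring

theorem exists_ker_bound (j : Fin 2) (γ : Sobolev 2) (hγ : γ ∈ V) : ∃ C, 0 ≤ C ∧
    ∀ a b : ℝ, a < b → b - a ≤ 1 / 2 →
      |ker j γ (b : Circ) (a : Circ)| ≤ C * ∫ t in a..b, accel γ (t : Circ) ∧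
      |ker j γ (a : Circ) (b : Circ)| ≤ C * ∫ t in a..b, accel γ (t : Circ) := by
  obtain ⟨C, hC0, hC⟩ := exists_kap_bound γ hγ
  obtain ⟨M, hM0, hM⟩ := exists_d1_bound γ
  have hγ' : 0 < chordArc γ := hγ
  have hn : ∀ x, |‖d1 γ x‖⁻¹ ^ 2 * nrm γ x j| ≤ (chordArc γ)⁻¹ ^ 2 * M := by
    intro x
    rw [abs_mul, abs_of_nonneg (by positivity)]
    have h1 : chordArc γ ≤ ‖d1 γ x‖ := by
      rw [norm_plane]
      exact Real.le_sqrt_of_sq_le (d1_lower γ hγ x)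
    have h2 : |nrm γ x j| ≤ M := by
      fin_cases j
      · exact hM x 1
      · simpa [nrm] using hM x 0
    gcongr
  refine ⟨(chordArc γ)⁻¹ ^ 2 * M * C, by positivity, fun a b hab hb => ⟨?_, ?_⟩⟩
  · rw [ker, abs_mul, mul_assoc _ C]
    exact mul_le_mul (hn _) (hC a b hab hb) (abs_nonneg _) (by positivity)
  · rw [ker, abs_mul, mul_assoc _ C, kap_comm]
    exact mul_le_mul (hn _) (hC a b hab hb) (abs_nonneg _) (by positivity)

/-- If `h` has an integrable almost everywhere derivative, is absolutely continuous on the compact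
subintervals of `(a, b)` and vanishes at the end points, its derivative has integral zero. -/
theorem integral_eq_zero_of_tendsto {h g : ℝ → ℝ} {a b : ℝ} (hab : a < b)
    (hg : IntervalIntegrable g volume a b)
    (hac : ∀ c d, a < c → c ≤ d → d < b → HasACDeriv h g c d)
    (ha : Tendsto h (𝓝[>] a) (𝓝 0)) (hb : Tendsto h (𝓝[<] b) (𝓝 0)) :
    ∫ x in a..b, g x = 0 := by
  set m := (a + b) / 2 with hm
  have ham : a < m := by rw [hm]; linarith
  have hmb : m < b := by rw [hm]; linarith
  have hg' : IntegrableOn g (uIcc a b) := by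
    rw [uIcc_of_le hab.le]
    exact (intervalIntegrable_iff_integrableOn_Icc_of_le hab.le).mp hg
  have hcont : ContinuousOn (fun x => ∫ t in m..x, g t) (uIcc a b) :=
    intervalIntegral.continuousOn_primitive_interval' hg
      (by rw [uIcc_of_le hab.le]; exact ⟨ham.le, hmb.le⟩)
  rw [uIcc_of_le hab.le] at hcont
  have t1 : Tendsto (fun x => ∫ t in m..x, g t) (𝓝[<] b) (𝓝 (∫ t in m..b, g t)) :=
    ((hcont b ⟨hab.le, le_rfl⟩).mono_of_mem_nhdsWithin (by
      filter_upwards [Ioo_mem_nhdsLT hab] with x hx using ⟨hx.1.le, hx.2.le⟩))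
  have t2 : Tendsto (fun x => ∫ t in m..x, g t) (𝓝[>] a) (𝓝 (∫ t in m..a, g t)) :=
    ((hcont a ⟨le_rfl, hab.le⟩).mono_of_mem_nhdsWithin (by
      filter_upwards [Ioo_mem_nhdsGT hab] with x hx using ⟨hx.1.le, hx.2.le⟩))
  have e1 : Tendsto (fun x => ∫ t in m..x, g t) (𝓝[<] b) (𝓝 (0 - h m)) := by
    refine (hb.sub_const (h m)).congr' ?_
    filter_upwards [Ioo_mem_nhdsLT hmb] with x hx
    rw [(hac m x ham hx.1.le hx.2).integral_eq]
  have e2 : Tendsto (fun x => ∫ t in m..x, g t) (𝓝[>] a) (𝓝 (0 - h m)) := by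
    refine (ha.sub_const (h m)).congr' ?_
    filter_upwards [Ioo_mem_nhdsGT ham] with x hx
    rw [intervalIntegral.integral_symm, (hac x m hx.1 hx.2.le hmb).integral_eq]
    ring
  have f1 := tendsto_nhds_unique t1 e1
  have f2 := tendsto_nhds_unique t2 e2
  have hi1 : IntervalIntegrable g volume a m :=
    hg.mono_set (by rw [uIcc_of_le ham.le, uIcc_of_le hab.le]; exact Icc_subset_Icc_right hmb.le)
  have hi2 : IntervalIntegrable g volume m b :=
    hg.mono_set (by rw [uIcc_of_le hmb.le, uIcc_of_le hab.le]; exact Icc_subset_Icc_left ham.le)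
  rw [← intervalIntegral.integral_add_adjacent_intervals hi1 hi2, f1,
    intervalIntegral.integral_symm, f2]
  ring

/-- The bound is the integral of |γ''|² over a shrinking arc. -/
theorem tendsto_ker (j : Fin 2) {γ : Sobolev 2} (hγ : γ ∈ V) (r : ℝ) :
    Tendsto (fun s : ℝ => ker j γ (r : Circ) (s : Circ)) (𝓝[>] r) (𝓝 0) ∧
    Tendsto (fun s : ℝ => ker j γ (r : Circ) (s : Circ)) (𝓝[<] r) (𝓝 0) := by
  obtain ⟨C, hC0, hC⟩ := exists_ker_bound j γ hγ
  have hcont : Continuous fun s : ℝ => C * ∫ t in r..s, accel γ (t : Circ) :=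
    continuous_const.mul (intervalIntegral.continuous_primitive (integrable_lift (integrable_accel γ)) r)
  have hlim : Tendsto (fun s : ℝ => C * ∫ t in r..s, accel γ (t : Circ)) (𝓝 r) (𝓝 0) := by
    have := hcont.tendsto r
    simpa using this
  constructor
  · refine squeeze_zero_norm' ?_ (hlim.mono_left nhdsWithin_le_nhds)
    filter_upwards [Ioo_mem_nhdsGT (show r < r + 1 / 2 by linarith)] with s hs
    exact (hC r s hs.1 (by linarith [hs.2])).2
  · have hlim' := hlim.neg
    rw [neg_zero] at hlim'
    refine squeeze_zero_norm' ?_ (hlim'.mono_left nhdsWithin_le_nhds)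
    filter_upwards [Ioo_mem_nhdsLT (show r - 1 / 2 < r by linarith)] with s hs
    have := (hC s r hs.2 (by linarith [hs.1])).1
    rw [intervalIntegral.integral_symm, mul_neg] at this
    exact this

/-- The circle is cut at the singular point y. Both ends of the resulting interval represent y, and
the kernel tends to zero at both. -/
theorem integral_test_ker (j : Fin 2) {γ : Sobolev 2} (hγ : γ ∈ V) (y : Circ) {φ : Circ → ℝ}
    (hφ : IsTest φ) (hi : Integrable fun x => circDeriv φ x * ker j γ y x + φ x * dker j γ y x) :
    ∫ x, (circDeriv φ x * ker j γ y x + φ x * dker j γ y x) = 0 := by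
  induction y using QuotientAddGroup.induction_on with | H r => ?_
  rw [← UnitAddCircle.intervalIntegral_preimage r]
  have hφl : Continuous fun s : ℝ => φ (s : Circ) := ContDiff.continuous hφ
  have hper : ((r + 1 : ℝ) : Circ) = (r : Circ) := AddCircle.coe_add_period 1 r
  have ht : ∀ {l : Filter ℝ} {q : ℝ}, l ≤ 𝓝 q →
      Tendsto (fun s : ℝ => ker j γ (r : Circ) (s : Circ)) l (𝓝 0) →
      Tendsto (fun s : ℝ => φ (s : Circ) * ker j γ (r : Circ) (s : Circ)) l (𝓝 0) := by
    intro l q hl hk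
    have := ((hφl.tendsto q).mono_left hl).mul hk
    rwa [mul_zero] at this
  refine integral_eq_zero_of_tendsto (h := fun s : ℝ => φ (s : Circ) * ker j γ (r : Circ) (s : Circ))
    (by linarith) (integrable_lift hi _ _) (fun c d hc hcd hd => ?_) ?_ ?_
  · refine HasACDeriv.mul ⟨(ContDiff.of_le hφ (by simp)).contDiffOn.absolutelyContinuousOnInterval,
      Eventually.of_forall fun s _ => hasDerivAt_circDeriv hφ s⟩ (hasACDeriv_ker j hγ _ ?_)
    intro s hs hsr
    rw [uIcc_of_le hcd] at hs
    have h1 : s ∈ Ico r (r + 1) := ⟨by linarith [hs.1], by linarith [hs.2]⟩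
    have h2 : r ∈ Ico r (r + 1) := ⟨le_rfl, by linarith⟩
    have := (AddCircle.coe_eq_coe_iff_of_mem_Ico h1 h2).mp hsr
    linarith [hs.1]
  · exact ht nhdsWithin_le_nhds (tendsto_ker j hγ r).1
  · refine ht nhdsWithin_le_nhds ?_
    have := (tendsto_ker j hγ (r + 1)).2
    rwa [hper] at this

/-! ### The weak derivative of the forcing, by Fubini. -/

theorem ae_ne (y : Circ) : ∀ᵐ x : Circ, x ≠ y := by
  have h : volume ({y} : Set Circ) = 0 := by
    rw [← Metric.closedBall_zero, AddCircle.volume_closedBall]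
    simp
  simpa [ae_iff] using h

theorem isWeakDerivReal_forceL (j : Fin 2) {γ : Sobolev 2} (hγ : γ ∈ V) :
    IsWeakDerivReal (forceL j γ) (dforceL j γ) := by
  intro φ hφ
  have h1 := isSmoothDensity_forceL j
  have h2 := isSmoothDensity_dforceL j
  have i1 := h1.integrable γ hγ _ hφ.continuous_circDeriv
  have i2 := h2.integrable γ hγ _ hφ.continuous
  rw [h1.integral_eq γ hγ _ hφ.continuous_circDeriv, h2.integral_eq γ hγ _ hφ.continuous,
    eq_neg_iff_add_eq_zero, ← integral_add i1 i2]
  have i3 : Integrable fun p : Circ × Circ =>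
      circDeriv φ p.1 * forceH j γ p + φ p.1 * dforceH j γ p := i1.add i2
  rw [Measure.volume_eq_prod] at i3 ⊢
  rw [integral_prod_symm _ i3]
  refine integral_eq_zero_of_ae ?_
  filter_upwards [i3.prod_left_ae] with y hy
  have hae : (fun x => circDeriv φ x * forceH j γ (x, y) + φ x * dforceH j γ (x, y)) =ᵐ[volume]
      fun x => (1 / (2 * Real.pi) * srcY γ y) *
        (circDeriv φ x * ker j γ y x + φ x * dker j γ y x) := by
    filter_upwards [ae_ne y] with x hx
    rw [forceH_eq j hγ hx, dforceH_eq j hγ hx, ker, dker]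
    ring
  rw [Pi.zero_apply]
  rw [integral_congr_ae hae, integral_const_mul]
  -- Integrability of the x-integrand can be extracted from that of the product only when the factor
  -- at y is nonzero; otherwise the integral is trivially zero.
  by_cases h0 : 1 / (2 * Real.pi) * srcY γ y = 0
  · rw [h0, zero_mul]
  · have := hy.congr hae
    rw [integrable_const_mul_iff (isUnit_iff_ne_zero.mpr h0)] at this
    rw [integral_test_ker j hγ y hφ this, mul_zero]

/-! ### The forcing -/

theorem inner_plane (v w : Plane) : inner ℝ v w = v 0 * w 0 + v 1 * w 1 := by
  rw [PiLp.inner_apply, Fin.sum_univ_two]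
  simp [mul_comm]

theorem normal_apply (γ : Sobolev 2) (x : Circ) (j : Fin 2) :
    normal γ x j = ‖d1 γ x‖⁻¹ * nrm γ x j := by
  fin_cases j <;> simp [normal, tangent, nrm]

theorem inner_normal (γ : Sobolev 2) (x : Circ) (v : Plane) :
    inner ℝ (normal γ x) v = ‖d1 γ x‖⁻¹ * tn γ x v := by
  rw [inner_plane, normal_apply, normal_apply, tn]
  simp only [nrm, Matrix.cons_val_zero, Matrix.cons_val_one]
  ring

theorem kernel_eq (γ : Sobolev 2) (x y : Circ) :
    kernel γ x y = ‖d1 γ x‖⁻¹ * ‖d1 γ y‖⁻¹ * kap γ x y := by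
  rw [kernel, inner_normal, inner_normal, kap]
  ring

/-- The minus sign here cancels the one in `nonlocalF`, which is why `forceL` carries +1/(2π). -/
theorem curvature_ae (γ : Sobolev 2) :
    ∀ᵐ y, ‖d1 γ y‖⁻¹ * curvature γ y = -srcY γ y := by
  filter_upwards [cls_ae 2 0 γ, cls_ae 2 1 γ] with y h0 h1
  rw [curvature, inner_normal, srcY, h0, h1, tn, d2]
  ring

/-- Any two points are joined by an arc of length at most 1/2, and the integral over it is at most
the total one. On the diagonal the chord is zero and so is `kap`. -/
theorem exists_kap_bound' (γ : Sobolev 2) (hγ : γ ∈ V) : ∃ C, ∀ x y : Circ, |kap γ x y| ≤ C := by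
  obtain ⟨C, hC0, hC⟩ := exists_kap_bound γ hγ
  have hi := integrable_accel γ
  have hnn : ∀ x, 0 ≤ accel γ x := fun x => by unfold accel; positivity
  have key : ∀ a b : ℝ, a < b → b - a ≤ 1 / 2 →
      |kap γ (a : Circ) (b : Circ)| ≤ C * ∫ x, accel γ x := by
    intro a b hab hb
    refine (hC a b hab hb).trans (mul_le_mul_of_nonneg_left ?_ hC0)
    rw [← UnitAddCircle.intervalIntegral_preimage a]
    exact intervalIntegral.integral_mono_interval le_rfl hab.le (by linarith)
      (Eventually.of_forall fun t => hnn _) (integrable_lift hi _ _)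
  refine ⟨C * ∫ x, accel γ x, fun x y => ?_⟩
  obtain ⟨a, b, rfl, rfl, hab⟩ := exists_lift_near x y
  rcases lt_trichotomy a b with h | h | h
  · exact key a b h ((le_abs_self _).trans hab)
  · rw [h]
    have : kap γ (b : Circ) (b : Circ) = 0 := by simp [kap, chord]
    rw [this, abs_zero]
    exact mul_nonneg hC0 (integral_nonneg hnn)
  · rw [kap_comm]
    exact key b a h (by linarith [neg_abs_le (b - a)])

theorem continuous_chord (γ : Sobolev 2) : Continuous fun p : Circ × Circ => chord γ p.1 p.2 :=
  ((continuous_val γ).comp continuous_snd).sub ((continuous_val γ).comp continuous_fst)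

theorem continuous_tn_chord (γ : Sobolev 2) :
    Continuous fun q : Circ × Circ × Circ => tn γ q.1 (chord γ q.2.1 q.2.2) := by
  have h := (continuous_chord γ).comp (continuous_snd (X := Circ))
  have hc : ∀ i, Continuous fun q : Circ × Circ × Circ => chord γ q.2.1 q.2.2 i := fun i =>
    (EuclideanSpace.proj i : Plane →L[ℝ] ℝ).continuous.comp h
  have hd : ∀ i, Continuous fun q : Circ × Circ × Circ => d1 γ q.1 i := fun i =>
    (continuous_d1_coord γ i).comp continuous_fst
  exact ((hd 1).mul (hc 0)).sub ((hd 0).mul (hc 1))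

theorem measurable_kap (γ : Sobolev 2) : Measurable fun p : Circ × Circ => kap γ p.1 p.2 := by
  have h1 := (continuous_tn_chord γ).comp
    (continuous_fst.prodMk (continuous_fst.prodMk continuous_snd) :
      Continuous fun p : Circ × Circ => (p.1, p.1, p.2))
  have h2 := (continuous_tn_chord γ).comp
    (continuous_snd.prodMk (continuous_fst.prodMk continuous_snd) :
      Continuous fun p : Circ × Circ => (p.2, p.1, p.2))
  exact (h1.measurable.mul h2.measurable).mul ((continuous_chord γ).norm.measurable.inv.pow_const 3)

theorem continuousAt_kap {γ : Sobolev 2} (hγ : γ ∈ V) {x y : Circ} (h : x ≠ y) :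
    ContinuousAt (fun x => kap γ x y) x := by
  have h1 : Continuous fun x : Circ => tn γ x (chord γ x y) := (continuous_tn_chord γ).comp
    (continuous_id.prodMk (continuous_id.prodMk continuous_const))
  have h2 : Continuous fun x : Circ => tn γ y (chord γ x y) := (continuous_tn_chord γ).comp
    (continuous_const.prodMk (continuous_id.prodMk continuous_const))
  have h3 : Continuous fun x : Circ => chord γ x y :=
    (continuous_chord γ).comp (continuous_id.prodMk continuous_const)
  exact (h1.mul h2).continuousAt.mul
    ((h3.norm.continuousAt.inv₀ (norm_ne_zero_iff.mpr (chord_ne_zero hγ h))).pow 3)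

theorem continuous_inv_speed {γ : Sobolev 2} (hγ : γ ∈ V) : Continuous fun x => ‖d1 γ x‖⁻¹ :=
  (continuous_d1 γ).norm.inv₀ fun x => norm_ne_zero_iff.mpr (d1_ne_zero hγ x)

theorem integrable_srcY {γ : Sobolev 2} (hγ : γ ∈ V) : Integrable (srcY γ) := by
  have h : Continuous fun x => ‖d1 γ x‖⁻¹ ^ 3 := (continuous_inv_speed hγ).pow 3
  have h1 := integrable_mul_L2r (φ := fun x => ‖d1 γ x‖⁻¹ ^ 3 * d1 γ x 1) (h.mul (continuous_d1_coord γ 1)) (cls 2 0 γ)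
  have h0 := integrable_mul_L2r (φ := fun x => ‖d1 γ x‖⁻¹ ^ 3 * d1 γ x 0) (h.mul (continuous_d1_coord γ 0)) (cls 2 1 γ)
  refine (h1.sub h0).congr (Eventually.of_forall fun y => ?_)
  simp only [srcY, Pi.sub_apply]
  ring

theorem integrable_kap_srcY {γ : Sobolev 2} (hγ : γ ∈ V) (x : Circ) :
    Integrable fun y => kap γ x y * srcY γ y := by
  obtain ⟨C, hC⟩ := exists_kap_bound' γ hγ
  exact (integrable_srcY hγ).bdd_mul
    ((measurable_kap γ).comp measurable_prodMk_left).aestronglyMeasurable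
    (Eventually.of_forall fun y => hC x y)

theorem kernel_mul_curvature_ae (γ : Sobolev 2) (x : Circ) :
    (fun y => kernel γ x y * curvature γ y) =ᵐ[volume]
      fun y => -‖d1 γ x‖⁻¹ * (kap γ x y * srcY γ y) := by
  filter_upwards [curvature_ae γ] with y hy
  rw [kernel_eq]
  linear_combination ‖d1 γ x‖⁻¹ * kap γ x y * hy

theorem integrable_kernel_mul_curvature {γ : Sobolev 2} (hγ : γ ∈ V) (x : Circ) :
    Integrable fun y => kernel γ x y * curvature γ y :=
  ((integrable_kap_srcY hγ x).const_mul _).congr (kernel_mul_curvature_ae γ x).symm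

theorem forcing_apply (γ : Sobolev 2) (x : Circ) (j : Fin 2) :
    forcing γ x j = (1 / (2 * Real.pi)) *
      (‖d1 γ x‖⁻¹ ^ 2 * nrm γ x j * ∫ y, kap γ x y * srcY γ y) := by
  rw [forcing, PiLp.smul_apply, nonlocalF, integral_congr_ae (kernel_mul_curvature_ae γ x),
    integral_const_mul, normal_apply, smul_eq_mul]
  ring

theorem continuous_nrm (γ : Sobolev 2) (j : Fin 2) : Continuous fun x => nrm γ x j := by
  fin_cases j
  · exact continuous_d1_coord γ 1
  · exact (continuous_d1_coord γ 0).neg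

/-- Dominated convergence: the kernel is bounded, the density is integrable, and for y ≠ x₀ the
kernel is continuous in x at x₀. -/
theorem continuous_forcing {γ : Sobolev 2} (hγ : γ ∈ V) : Continuous (forcing γ) := by
  obtain ⟨C, hC⟩ := exists_kap_bound' γ hγ
  have hint : Continuous fun x => ∫ y, kap γ x y * srcY γ y := by
    rw [continuous_iff_continuousAt]
    intro x₀
    refine continuousAt_of_dominated (bound := fun y => C * |srcY γ y|)
      (Eventually.of_forall fun x => (integrable_kap_srcY hγ x).aestronglyMeasurable)
      (Eventually.of_forall fun x => Eventually.of_forall fun y => ?_)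
      ((integrable_srcY hγ).abs.const_mul C) ?_
    · rw [norm_mul]
      exact mul_le_mul_of_nonneg_right (hC x y) (abs_nonneg _)
    · filter_upwards [ae_ne x₀] with y hy
      exact (continuousAt_kap hγ hy.symm).mul continuousAt_const
  have hcoord : ∀ j, Continuous fun x => forcing γ x j := fun j => by
    simp_rw [forcing_apply]
    exact continuous_const.mul ((((continuous_inv_speed hγ).pow 2).mul (continuous_nrm γ j)).mul hint)
  have : forcing γ = fun x => (WithLp.toLp 2 fun i => forcing γ x i : Plane) := by
    funext x; rfl
  rw [this]
  exact (PiLp.continuous_toLp 2 _).comp (continuous_pi hcoord)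

/-- Both sides have the same integrals against continuous functions. Derivatives of test functions
show that the difference is constant, and the function 1 shows that the constant is zero. -/
theorem forceL_ae (j : Fin 2) {γ : Sobolev 2} (hγ : γ ∈ V) :
    forceL j γ =ᵐ[volume] fun x => forcing γ x j := by
  have hc : Continuous fun x => forcing γ x j :=
    (EuclideanSpace.proj j : Plane →L[ℝ] ℝ).continuous.comp (continuous_forcing hγ)
  have hcm : MemLp (fun x => forcing γ x j) 2 :=
    hc.memLp_of_hasCompactSupport (HasCompactSupport.of_compactSpace _)
  have hdens := isSmoothDensity_forceL j
  have hzero : ∀ φ : Circ → ℝ, Continuous φ →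
      ∫ x, φ x * (forceL j γ x - forcing γ x j) = 0 := by
    intro φ hφ
    have hcc : Continuous fun x => φ x * forcing γ x j := hφ.mul hc
    have i2 : Integrable fun x => φ x * forcing γ x j :=
      hcc.integrable_of_hasCompactSupport (HasCompactSupport.of_compactSpace _)
    simp_rw [mul_sub]
    rw [integral_sub (integrable_mul_L2r hφ _) i2, hdens.integral_eq γ hγ φ hφ, sub_eq_zero]
    have i3 := hdens.integrable γ hγ φ hφ
    rw [Measure.volume_eq_prod] at i3 ⊢
    rw [integral_prod _ i3]
    refine integral_congr_ae (Eventually.of_forall fun x => ?_)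
    change ∫ y, φ x * forceH j γ (x, y) = φ x * forcing γ x j
    have h : (fun y => forceH j γ (x, y)) =ᵐ[volume] fun y =>
        1 / (2 * Real.pi) * (‖d1 γ x‖⁻¹ ^ 2 * nrm γ x j * (kap γ x y * srcY γ y)) := by
      filter_upwards [ae_ne x] with y hy
      rw [forceH_eq j hγ hy.symm]
      ring
    rw [integral_const_mul, integral_congr_ae h, integral_const_mul, integral_const_mul, forcing_apply]
  have hm : MemLp (fun x => forceL j γ x - forcing γ x j) 2 := (Lp.memLp (forceL j γ)).sub hcm
  obtain ⟨c, hcst⟩ := ae_eq_const_of_forall_test hm fun φ hφ => hzero _ hφ.continuous_circDeriv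
  have h1 := hzero (fun _ => 1) continuous_const
  simp only [one_mul] at h1
  rw [integral_congr_ae hcst] at h1
  have hc0 : c = 0 := by simpa using h1
  filter_upwards [hcst] with x hx
  rw [hc0] at hx
  linarith

/-! ### Assembly -/

/-- The `j`-th coordinate axis, as a map from `L²(𝕊¹; ℝ)` to `L²(𝕊¹; ℝ²)`. -/
def axisL (j : Fin 2) : L2r →L[ℝ] L2 :=
  (ContinuousLinearMap.toSpanSingleton ℝ (EuclideanSpace.single j (1 : ℝ) : Plane)).compLpL 2 volume

theorem coordL_axisL (i j : Fin 2) (u : L2r) :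
    coordL i (axisL j u) =ᵐ[volume] fun x => if i = j then u x else 0 := by
  filter_upwards [coordL_ae i (axisL j u), ContinuousLinearMap.coeFn_compLpL (p := 2)
    (ContinuousLinearMap.toSpanSingleton ℝ (EuclideanSpace.single j (1 : ℝ) : Plane)) u] with x h1 h2
  rw [h1, axisL, h2]
  simp

theorem coordL_sum_axisL (i : Fin 2) (u : Fin 2 → L2r) : coordL i (∑ j, axisL j (u j)) = u i := by
  rw [map_sum, Fin.sum_univ_two]
  refine Lp.ext ?_
  filter_upwards [Lp.coeFn_add (coordL i (axisL 0 (u 0))) (coordL i (axisL 1 (u 1))),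
    coordL_axisL i 0 (u 0), coordL_axisL i 1 (u 1)] with x h h0 h1
  rw [h, Pi.add_apply, h0, h1]
  fin_cases i <;> simp

theorem continuous_integral_smul {ψ : Circ → ℝ} (hψ : Continuous ψ) :
    Continuous fun u : L2 => ∫ x, ψ x • u x := by
  obtain ⟨C, hC⟩ := (isCompact_range hψ).isBounded.exists_norm_le
  have hC' : ∀ x, ‖ψ x‖ ≤ C := fun x => hC _ ⟨x, rfl⟩
  have hC0 : 0 ≤ C := (norm_nonneg _).trans (hC' 0)
  have hL1 : ∀ u : L2, ∫ x, ‖u x‖ ≤ ‖u‖ := by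
    intro u
    have h1 := eLpNorm_le_eLpNorm_of_exponent_le (μ := (volume : Measure Circ)) one_le_two
      (Lp.aestronglyMeasurable u)
    rw [eLpNorm_one_eq_lintegral_enorm] at h1
    rw [integral_norm_eq_lintegral_enorm (Lp.aestronglyMeasurable u), Lp.norm_def]
    exact ENNReal.toReal_mono (Lp.eLpNorm_ne_top u) h1
  let T : L2 →ₗ[ℝ] Plane :=
    { toFun := fun u => ∫ x, ψ x • u x
      map_add' := fun u v => by
        rw [← integral_add (integrable_smul_L2 hψ _) (integrable_smul_L2 hψ _)]
        refine integral_congr_ae ?_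
        filter_upwards [Lp.coeFn_add u v] with x hx
        rw [hx, Pi.add_apply, smul_add]
      map_smul' := fun c u => by
        rw [RingHom.id_apply, ← integral_smul]
        refine integral_congr_ae ?_
        filter_upwards [Lp.coeFn_smul c u] with x hx
        rw [hx, Pi.smul_apply, smul_comm] }
  refine (T.mkContinuous C fun u => ?_).continuous
  calc ‖∫ x, ψ x • u x‖ ≤ ∫ x, ‖ψ x • u x‖ := norm_integral_le_integral_norm _
    _ ≤ ∫ x, C * ‖u x‖ := by
        refine integral_mono (integrable_smul_L2 hψ u).norm
          (((Lp.memLp u).integrable one_le_two).norm.const_mul C) fun x => ?_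
        rw [norm_smul]
        exact mul_le_mul_of_nonneg_right (hC' x) (norm_nonneg _)
    _ ≤ C * ‖u‖ := by
        rw [integral_const_mul]
        exact mul_le_mul_of_nonneg_left (hL1 u) hC0

/-- Each weak derivative identity is a closed condition. Completeness follows, and with it the
orthogonal projection onto the Sobolev space. -/
theorem isClosed_sobolev (k : ℕ) : IsClosed (Sobolev k : Set (PiLp 2 fun _ : Fin (k + 1) => L2)) := by
  have hset : (Sobolev k : Set (PiLp 2 fun _ : Fin (k + 1) => L2)) =
      ⋂ (j : Fin k) (φ : {φ : Circ → ℝ // IsTest φ}),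
        {u | (∫ x, circDeriv φ.1 x • u j.castSucc x) = -(∫ x, φ.1 x • u j.succ x)} := by
    ext u
    simp only [mem_iInter, Subtype.forall]
    rfl
  rw [hset]
  refine isClosed_iInter fun j => isClosed_iInter fun φ => isClosed_eq ?_ ?_
  · exact (continuous_integral_smul φ.2.continuous_circDeriv).comp
      (PiLp.proj 2 (fun _ : Fin (k + 1) => L2) j.castSucc (𝕜 := ℝ)).continuous
  · exact ((continuous_integral_smul φ.2.continuous).comp
      (PiLp.proj 2 (fun _ : Fin (k + 1) => L2) j.succ (𝕜 := ℝ)).continuous).neg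

instance (k : ℕ) : CompleteSpace (Sobolev k) := (isClosed_sobolev k).completeSpace_coe

/-- The forcing and its derivative, as an element of the ambient space of `H¹`. -/
def forcePair (γ : Sobolev 2) : PiLp 2 fun _ : Fin (1 + 1) => L2 :=
  (PiLp.continuousLinearEquiv 2 ℝ fun _ : Fin (1 + 1) => L2).symm
    ![∑ j, axisL j (forceL j γ), ∑ j, axisL j (dforceL j γ)]

theorem contDiffOn_forcePair : ContDiffOn ℝ ∞ forcePair V := by
  refine (PiLp.continuousLinearEquiv 2 ℝ fun _ : Fin (1 + 1) => L2).symm.contDiff.comp_contDiffOn ?_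
  rw [contDiffOn_pi]
  intro i
  fin_cases i
  · have h : ContDiffOn ℝ ∞ (fun γ => ∑ j, axisL j (forceL j γ)) V := ContDiffOn.sum fun j _ =>
      (axisL j).contDiff.comp_contDiffOn (isSmoothDensity_forceL j).contDiffOn
    exact h
  · have h : ContDiffOn ℝ ∞ (fun γ => ∑ j, axisL j (dforceL j γ)) V := ContDiffOn.sum fun j _ =>
      (axisL j).contDiff.comp_contDiffOn (isSmoothDensity_dforceL j).contDiffOn
    exact h

theorem forcePair_mem {γ : Sobolev 2} (hγ : γ ∈ V) : forcePair γ ∈ Sobolev 1 := by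
  intro i
  have hi : i = 0 := Subsingleton.elim _ _
  subst hi
  change IsWeakDeriv (∑ j, axisL j (forceL j γ) : L2) (∑ j, axisL j (dforceL j γ) : L2)
  rw [isWeakDeriv_iff]
  intro i
  rw [coordL_sum_axisL i fun j => forceL j γ, coordL_sum_axisL i fun j => dforceL j γ]
  exact isWeakDerivReal_forceL i hγ

theorem forcing_ae {γ : Sobolev 2} (hγ : γ ∈ V) : forcing γ =ᵐ[volume] (forcePair γ 0 : L2) := by
  have h : ∀ i, (fun x => (forcePair γ 0 : L2) x i) =ᵐ[volume] fun x => forcing γ x i := by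
    intro i
    have h1 := coordL_ae i (forcePair γ 0)
    have h2 : coordL i (forcePair γ 0) = forceL i γ := coordL_sum_axisL i fun j => forceL j γ
    rw [h2] at h1
    exact h1.symm.trans (forceL_ae i hγ)
  filter_upwards [h 0, h 1] with x h0 h1
  ext i
  fin_cases i
  · exact h0.symm
  · exact h1.symm

end Langmuir

end

/-- `V` is open in `H²`, the integral that defines `F(γ)` converges at every point for `γ ∈ V`, and
`γ ↦ f(γ) = F(γ) ν(γ)` is a well-defined map of class `C^∞` from `V` into `H¹`. -/
theorem proposition4p12 :
    IsOpen Langmuir.V ∧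
    (∀ γ ∈ Langmuir.V, ∀ x : Langmuir.Circ,
      Integrable (fun y => Langmuir.kernel γ x y * Langmuir.curvature γ y)) ∧
    ∃ f : Langmuir.Sobolev 2 → Langmuir.Sobolev 1,
      (∀ γ ∈ Langmuir.V, ∀ x : Langmuir.Circ,
        Langmuir.val (f γ) x = Langmuir.forcing γ x) ∧
      ContDiffOn ℝ ∞ f Langmuir.V := by
  refine ⟨Langmuir.isOpen_V, fun γ hγ x => Langmuir.integrable_kernel_mul_curvature hγ x,
    -- The projection makes the map take values in `Sobolev 1` for every γ, including those outside
    -- V. It is continuous and linear, hence preserves smoothness, and on V it changes nothing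
    -- because `forcePair γ` already lies in the subspace.
    fun γ => (Langmuir.Sobolev 1).orthogonalProjectionOnto (Langmuir.forcePair γ), fun γ hγ x => ?_,
    (Langmuir.Sobolev 1).orthogonalProjectionOnto.contDiff.comp_contDiffOn
      Langmuir.contDiffOn_forcePair⟩
  have hproj : (((Langmuir.Sobolev 1).orthogonalProjectionOnto (Langmuir.forcePair γ) :
      Langmuir.Sobolev 1) : PiLp 2 fun _ : Fin (1 + 1) => Langmuir.L2) = Langmuir.forcePair γ :=
    congrArg Subtype.val (Submodule.orthogonalProjectionOnto_mem_subspace_eq_self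
      (⟨_, Langmuir.forcePair_mem hγ⟩ : Langmuir.Sobolev 1))
  rw [Langmuir.val, hproj]
  exact congrFun (Langmuir.contRep_eq (Langmuir.continuous_forcing hγ) (Langmuir.forcing_ae hγ)) x
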